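/- Consider the binary erasure channel with input alphabet $\{0,1\}$, output alphabet $\{0,1,\mathrm e\}$ and erasure probability $\alpha\in[0,1]$, used by a transmitter with a unit battery that is recharged at every odd time: at times $t=1,2,\dots$ the inputs must satisfy $X_t\le B_t$, where $B_t=\min\{B_{t-1}-X_{t-1}+E_t,1\}$, $E_t=1$ for $t$ odd and $E_t=0$ for $t$ even (so that $B_t=1$ for $t$ odd and $B_t=1-X_{t-1}$ for $t$ even). An $(M,n)$ code without feedback has an encoder $w\mapsto x^n(w)$; an $(M,n)$ code with feedback has encoding functions $x_t=f_t(w,y^{t-1})$; in both cases $w\in\{1,\dots,M\}$, all inputs satisfy the energy constraint, and the receiver decodes $w$ from $y^n$. A rate $R\ge 0$ is achievable if there are $(\lceil 2^{nR}\rceil,n)$ codes, $n = 0, 1, 2,\dots$, whose average error probability tends to $0$. Let $C(\alpha)$ and $C_{\mathrm{fb}}(\alpha)$ denote the suprema of the rates achievable without and with feedback, respectively. Logarithms are to base $2$. For every $\alpha\in[0,1]$, $$C_{\mathrm{fb}}(\alpha)=\frac12\max I(X^2\to Y^2),\qquad I(X^2\to Y^2)=I(X_1;Y_1)+I(X_1,X_2;Y_2\mid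 Y_1),$$ where $(X_1,Y_1,X_2,Y_2)$ has law $p(x_1)W(y_1|x_1)p(x_2|x_1,y_1)W(y_2|x_2)$, $W$ is the erasure channel, and the maximum (which is attained) is over all causally conditioned input distributions $p(x_1)\,p(x_2|x_1,y_1)$ with $p(x_2=1\mid x_1=1,y_1)=0$ for all $y_1$. Its value gives $$C_{\mathrm{fb}}(\alpha)=\frac{1-\alpha}{2}\left[\log\left(1+2^{1-\alpha}\right)+\alpha\right],$$ and the maximum is attained by an input distribution with $p(x_1=1)=p_1:=\dfrac{1}{1+2^{1-\alpha}}$, $p(x_2=1\mid x_1=0,y_1=0)=\frac12$ and $p(x_2=1\mid x_1=0,y_1=\mathrm e)=\min\left\{\frac{1}{2(1-p_1)},1\right\}$. In particular $C_{\mathrm{fb}}(1/2)\approx 0.4429$ (with error less than $5\cdot10^{-5}$) and $C_{\mathrm{fb}}(1/2)>C(1/2)$, so feedback strictly increases the capacity. -/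

import Mathlib

noncomputable section

namespace EHBEC

open Filter Topology

/-- Channel outputs `{0, 1, e}`; the erasure `e` is `none`. -/
abbrev Output : Type := Option (Fin 2)

/-- Transition probability `W(y|x)` of the binary erasure channel with erasure probability `α`. -/
def bec (α : ℝ) (x : Fin 2) (y : Output) : ℝ :=
  if y = none then α else if y = some x then 1 - α else 0

/-! ### The energy constraint -/

/-- The deterministic energy arrivals `E_t`, `t = 1, 2, …`. -/
def energyArrival (t : ℕ) : ℤ := if Odd t then 1 else 0

/-- The symbol `x_t` sent at time `t ∈ {1, …, n}` (nothing is sent at other times);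
the entry of `x` with index `i` is sent at time `i + 1`. -/
def symbolAt {n : ℕ} (x : Fin n → Fin 2) (t : ℕ) : ℤ :=
  if h : 1 ≤ t ∧ t ≤ n then ((x ⟨t - 1, by omega⟩ : ℕ) : ℤ) else 0

/-- The battery level: `B_0 = 1` and `B_t = min {B_{t-1} - x_{t-1} + E_t, 1}`. -/
def battery {n : ℕ} (x : Fin n → Fin 2) : ℕ → ℤ
  | 0 => 1
  | t + 1 => min (battery x t - symbolAt x t + energyArrival (t + 1)) 1

/-- The energy constraint `x_t ≤ B_t` for `t = 1, …, n`. -/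
def EnergyFeasible {n : ℕ} (x : Fin n → Fin 2) : Prop :=
  ∀ t : ℕ, 1 ≤ t → t ≤ n → symbolAt x t ≤ battery x t

/-! ### Codes and capacities -/

/-- An `(M, n)` code without feedback. -/
structure Code (M n : ℕ) where
  /-- the encoding function -/
  enc : Fin M → Fin n → Fin 2
  /-- the decoding function -/
  dec : (Fin n → Output) → Fin M
  feasible : ∀ w, EnergyFeasible (enc w)

/-- Average probability of error, for a uniformly distributed message. -/
def Code.errorProb {M n : ℕ} (c : Code M n) (α : ℝ) : ℝ :=
  (1 / (M : ℝ)) * ∑ w : Fin M, ∑ y : Fin n → Output,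
    if c.dec y ≠ w then ∏ i, bec α (c.enc w i) (y i) else 0

/-- The channel inputs that a feedback encoder produces for one message along the output
sequence `y`: the `i`-th input depends only on the outputs that precede it. -/
def feedbackInput {n : ℕ} (f : (i : Fin n) → (Fin i → Output) → Fin 2) (y : Fin n → Output) :
    Fin n → Fin 2 :=
  fun i => f i (fun j => y ⟨j, j.isLt.trans i.isLt⟩)

/-- An `(M, n)` code with causal output feedback, `x_t = f_t(w, y^{t-1})`. -/
structure FeedbackCode (M n : ℕ) where
  /-- the encoding functions -/
  enc : Fin M → (i : Fin n) → (Fin i → Output) → Fin 2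
  /-- the decoding function -/
  dec : (Fin n → Output) → Fin M
  feasible : ∀ w y, EnergyFeasible (feedbackInput (enc w) y)

/-- Average probability of error, for a uniformly distributed message. -/
def FeedbackCode.errorProb {M n : ℕ} (c : FeedbackCode M n) (α : ℝ) : ℝ :=
  (1 / (M : ℝ)) * ∑ w : Fin M, ∑ y : Fin n → Output,
    if c.dec y ≠ w then ∏ i, bec α (feedbackInput (c.enc w) y i) (y i) else 0

/-- The rates (in bits per channel use) achievable without feedback. -/
def achievableRates (α : ℝ) : Set ℝ :=
  {R | 0 ≤ R ∧ ∃ c : (n : ℕ) → Code ⌈(2 : ℝ) ^ ((n : ℝ) * R)⌉₊ n,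
    Tendsto (fun n => (c n).errorProb α) atTop (𝓝 0)}

/-- The rates (in bits per channel use) achievable with feedback. -/
def feedbackAchievableRates (α : ℝ) : Set ℝ :=
  {R | 0 ≤ R ∧ ∃ c : (n : ℕ) → FeedbackCode ⌈(2 : ℝ) ^ ((n : ℝ) * R)⌉₊ n,
    Tendsto (fun n => (c n).errorProb α) atTop (𝓝 0)}

/-- The capacity `C(α)` without feedback. -/
def capacity (α : ℝ) : ℝ := sSup (achievableRates α)

/-- The feedback capacity `C_fb(α)`. -/
def feedbackCapacity (α : ℝ) : ℝ := sSup (feedbackAchievableRates α)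

/-! ### Directed information over a block of two channel uses -/

/-- `P(X = a)` when the outcome `ω` has probability `p ω`. -/
def prob {Ω A : Type} [Fintype Ω] [DecidableEq A] (p : Ω → ℝ) (X : Ω → A) (a : A) : ℝ :=
  ∑ ω, if X ω = a then p ω else 0

/-- Mutual information `I(X;Y)` in bits. -/
def mutualInfo {Ω A B : Type} [Fintype Ω] [Fintype A] [Fintype B] [DecidableEq A] [DecidableEq B]
    (p : Ω → ℝ) (X : Ω → A) (Y : Ω → B) : ℝ :=
  ∑ a, ∑ b, prob p (fun ω => (X ω, Y ω)) (a, b) *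
    Real.logb 2 (prob p (fun ω => (X ω, Y ω)) (a, b) / (prob p X a * prob p Y b))

/-- Conditional mutual information `I(X;Y|Z)` in bits. -/
def condMutualInfo {Ω A B C : Type} [Fintype Ω] [Fintype A] [Fintype B] [Fintype C]
    [DecidableEq A] [DecidableEq B] [DecidableEq C]
    (p : Ω → ℝ) (X : Ω → A) (Y : Ω → B) (Z : Ω → C) : ℝ :=
  ∑ a, ∑ b, ∑ c, prob p (fun ω => (X ω, Y ω, Z ω)) (a, b, c) *
    Real.logb 2 (prob p Z c * prob p (fun ω => (X ω, Y ω, Z ω)) (a, b, c) /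
      (prob p (fun ω => (X ω, Z ω)) (a, c) * prob p (fun ω => (Y ω, Z ω)) (b, c)))

/-- A causally conditioned input distribution `p(x²‖y₁) = p(x₁) p(x₂|x₁,y₁)` that satisfies
the energy constraint `p(x₂ = 1 | x₁ = 1, y₁) = 0` for all `y₁`. -/
structure CausalInput where
  /-- `first x₁ = p(x₁)` -/
  first : Fin 2 → ℝ
  /-- `second x₁ y₁ x₂ = p(x₂|x₁,y₁)` -/
  second : Fin 2 → Output → Fin 2 → ℝ
  first_mem : first ∈ stdSimplex ℝ (Fin 2)
  second_mem : ∀ x₁ y₁, second x₁ y₁ ∈ stdSimplex ℝ (Fin 2)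
  energy : ∀ y₁, second 1 y₁ 1 = 0

/-- Joint law `p(x₁) W(y₁|x₁) p(x₂|x₁,y₁) W(y₂|x₂)` of `(x₁, y₁, x₂, y₂)`. -/
def CausalInput.joint (q : CausalInput) (α : ℝ) (ω : Fin 2 × Output × Fin 2 × Output) : ℝ :=
  q.first ω.1 * bec α ω.1 ω.2.1 * q.second ω.1 ω.2.1 ω.2.2.1 * bec α ω.2.2.1 ω.2.2.2

/-- Directed information `I(X² → Y²) = I(X₁;Y₁) + I(X₁,X₂;Y₂|Y₁)` in bits. -/
def directedInfo (α : ℝ) (q : CausalInput) : ℝ :=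
  mutualInfo (q.joint α) (fun ω => ω.1) (fun ω => ω.2.1) +
    condMutualInfo (q.joint α) (fun ω => (ω.1, ω.2.2.1)) (fun ω => ω.2.2.2) (fun ω => ω.2.1)

end EHBEC

end

noncomputable section

namespace EHBEC

open Filter Topology

/-! ### The energy constraint in blocks of two -/

/-! The battery is full at every odd time, so the energy constraint decouples into blocks of two
uses: in each block at most one symbol is `1` (`energyFeasible_iff`). With feedback, a block is one
use of a memoryless channel whose inputs are the strategies `(x₁, y₁ ↦ x₂)` with `x₁ = 0` or `x₂`
identically `0`.

Both halves of the capacity formula rest on a single pair: a reference law `Q` on the two outputs of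
a block (`feedbackLaw`) and a score `s` (`feedbackScore`). `Q` is the output law of an explicit
mixture of four strategies, and `Q * exp s` dominates the transition probability of every feasible
strategy, with equality where that probability is nonzero. For `p = firstOne α` the mean of `s` is
the same number `K` under every feasible strategy: sending `1` first forfeits the second symbol, and
this loss is balanced by the rarity of `1`.

Converse (`rate_le_of_blockBound`): changing measure from the code's output law to the product of
the `Q`s gives `(1 - ε) log M ≤ k K + 1` over `k` blocks, with no entropies involved. Achievability
(`mem_feedbackAchievableRates`): Feinstein's greedy construction on the strategy channel, with a
Chernoff bound for the information density `s`, reaches every rate below `K / (2 log 2)`.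

The directed information reduces to three binary entropies (`directedInfo_mul_log`). Gibbs'
inequality bounds the first and `log 2` the other two, and `optimalInput` turns all three bounds
into equalities.

At `α = 1/2` without feedback `x₂` cannot depend on `y₁`. Another reference law, `plainLaw`, fed
into the same converse, then gives an upper bound strictly below the feedback value. -/

theorem symbolAt_nonneg {n : ℕ} (x : Fin n → Fin 2) (t : ℕ) : 0 ≤ symbolAt x t := by
  unfold symbolAt
  split_ifs <;> omega

theorem symbolAt_le_one {n : ℕ} (x : Fin n → Fin 2) (t : ℕ) : symbolAt x t ≤ 1 := by
  unfold symbolAt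
  split_ifs <;> omega

theorem symbolAt_of_lt {n : ℕ} (x : Fin n → Fin 2) (t : ℕ) (h : n < t) : symbolAt x t = 0 := by
  unfold symbolAt
  rw [dif_neg (by omega)]

theorem symbolAt_succ {n : ℕ} (x : Fin n → Fin 2) (i : ℕ) (h : i < n) :
    symbolAt x (i + 1) = ((x ⟨i, h⟩ : ℕ) : ℤ) := by
  unfold symbolAt
  rw [dif_pos (by omega)]
  rfl

theorem battery_even {n : ℕ} (x : Fin n → Fin 2) (i : ℕ) (h : battery x (2 * i + 1) = 1) :
    battery x (2 * i + 2) = 1 - symbolAt x (2 * i + 1) := by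
  have h0 := symbolAt_nonneg x (2 * i + 1)
  have hE : energyArrival (2 * i + 1 + 1) = 0 := by
    unfold energyArrival
    rw [if_neg (by rw [Nat.odd_iff]; omega)]
  change min (battery x (2 * i + 1) - symbolAt x (2 * i + 1) + energyArrival (2 * i + 1 + 1)) 1 = _
  rw [hE, h]
  omega

theorem battery_odd_succ {n : ℕ} (x : Fin n → Fin 2) (i : ℕ) (h : battery x (2 * i + 1) = 1)
    (hs : symbolAt x (2 * i + 1) + symbolAt x (2 * i + 2) ≤ 1) :
    battery x (2 * (i + 1) + 1) = 1 := by
  have hE : energyArrival (2 * (i + 1) + 1) = 1 := by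
    unfold energyArrival
    rw [if_pos (by rw [Nat.odd_iff]; omega)]
  change min (battery x (2 * i + 2) - symbolAt x (2 * i + 2) + energyArrival (2 * (i + 1) + 1)) 1 = _
  rw [hE, battery_even x i h]
  omega

theorem battery_one {n : ℕ} (x : Fin n → Fin 2) : battery x (2 * 0 + 1) = 1 := by
  simp [battery, symbolAt, energyArrival]

/-- A block starting with a full battery spends at most one unit, and the recharge at the next odd
time restores it. So the level at odd times is always `1`, and no memory passes between blocks. -/
theorem energyFeasible_iff {n : ℕ} (x : Fin n → Fin 2) :
    EnergyFeasible x ↔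
      ∀ (i : ℕ) (h : 2 * i + 1 < n), x ⟨2 * i, by omega⟩ = 0 ∨ x ⟨2 * i + 1, h⟩ = 0 := by
  constructor
  · intro hx
    have key : ∀ i, battery x (2 * i + 1) = 1 →
        symbolAt x (2 * i + 1) + symbolAt x (2 * i + 2) ≤ 1 := by
      intro i hi
      by_cases hn : 2 * i + 2 ≤ n
      · have := hx (2 * i + 2) (by omega) hn
        rw [battery_even x i hi] at this
        omega
      -- An incomplete last block, or one beyond time `n`: its second symbol counts as `0`.
      · rw [symbolAt_of_lt x _ (not_le.mp hn)]
        have := symbolAt_le_one x (2 * i + 1)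
        omega
    have hb : ∀ i, battery x (2 * i + 1) = 1 := by
      intro i
      induction i with
      | zero => exact battery_one x
      | succ i ih => exact battery_odd_succ x i ih (key i ih)
    intro i h
    have := key i (hb i)
    rw [symbolAt_succ x (2 * i) (by omega), symbolAt_succ x (2 * i + 1) h] at this
    omega
  · intro hx
    have key : ∀ i, symbolAt x (2 * i + 1) + symbolAt x (2 * i + 2) ≤ 1 := by
      intro i
      by_cases hn : 2 * i + 2 ≤ n
      · rw [symbolAt_succ x (2 * i) (by omega), symbolAt_succ x (2 * i + 1) (by omega)]
        have := hx i hn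
        omega
      · rw [symbolAt_of_lt x _ (not_le.mp hn)]
        have := symbolAt_le_one x (2 * i + 1)
        omega
    have hb : ∀ i, battery x (2 * i + 1) = 1 := by
      intro i
      induction i with
      | zero => exact battery_one x
      | succ i ih => exact battery_odd_succ x i ih (key i)
    intro t ht _
    obtain ⟨i, rfl | rfl⟩ : ∃ i, t = 2 * i + 1 ∨ t = 2 * i + 2 := ⟨(t - 1) / 2, by omega⟩
    · rw [hb i]
      exact symbolAt_le_one x _
    · rw [battery_even x i (hb i)]
      have := key i
      omega

/-! ### Output laws of feedback encoders -/

theorem bec_nonneg {α : ℝ} (h0 : 0 ≤ α) (h1 : α ≤ 1) (x : Fin 2) (y : Output) :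
    0 ≤ bec α x y := by
  unfold bec
  split_ifs <;> linarith

@[simp] theorem bec_none (α : ℝ) (x : Fin 2) : bec α x none = α := by simp [bec]

@[simp] theorem bec_some (α : ℝ) (x b : Fin 2) :
    bec α x (some b) = if b = x then 1 - α else 0 := by simp [bec]

theorem sum_bec (α : ℝ) (x : Fin 2) : ∑ y, bec α x y = 1 := by
  simp [Fintype.sum_option]

/-- A feedback encoder for one message: the input at each time as a function of past outputs. -/
abbrev Encoder (n : ℕ) : Type := (i : Fin n) → (Fin i → Output) → Fin 2

/-- Probability of the output sequence `y` when the feedback encoder `f` is used. -/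
def outLaw (α : ℝ) {n : ℕ} (f : Encoder n) (y : Fin n → Output) : ℝ :=
  ∏ i, bec α (feedbackInput f y i) (y i)

/-- The encoder without its last channel use. -/
def Encoder.init {n : ℕ} (f : Encoder (n + 1)) : Encoder n := fun i => f i.castSucc

theorem sum_snoc {A : Type} [Fintype A] {n : ℕ} (F : (Fin (n + 1) → A) → ℝ) :
    ∑ z, F z = ∑ y : Fin n → A, ∑ b, F (Fin.snoc (α := fun _ => A) y b) := by
  rw [← (Fin.snocEquiv (fun _ : Fin (n + 1) => A)).sum_comp F, Fintype.sum_prod_type,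
    Finset.sum_comm]
  rfl

theorem outLaw_nonneg {α : ℝ} (h0 : 0 ≤ α) (h1 : α ≤ 1) {n : ℕ} (f : Encoder n)
    (y : Fin n → Output) : 0 ≤ outLaw α f y :=
  Finset.prod_nonneg fun _ _ => bec_nonneg h0 h1 _ _

theorem feedbackInput_snoc_castSucc {n : ℕ} (f : Encoder (n + 1)) (y : Fin n → Output)
    (b : Output) (i : Fin n) :
    feedbackInput f (Fin.snoc (α := fun _ => Output) y b) i.castSucc =
      feedbackInput f.init y i := by
  unfold feedbackInput Encoder.init
  congr 1
  funext j
  exact Fin.snoc_castSucc (α := fun _ => Output) b y ⟨j, j.isLt.trans i.isLt⟩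

theorem feedbackInput_snoc_last {n : ℕ} (f : Encoder (n + 1)) (y : Fin n → Output) (b : Output) :
    feedbackInput f (Fin.snoc (α := fun _ => Output) y b) (Fin.last n) = f (Fin.last n) y := by
  unfold feedbackInput
  congr 1
  funext j
  exact Fin.snoc_castSucc (α := fun _ => Output) b y j

theorem outLaw_snoc (α : ℝ) {n : ℕ} (f : Encoder (n + 1)) (y : Fin n → Output) (b : Output) :
    outLaw α f (Fin.snoc (α := fun _ => Output) y b) =
      outLaw α f.init y * bec α (f (Fin.last n) y) b := by
  unfold outLaw
  rw [Fin.prod_univ_castSucc]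
  simp only [feedbackInput_snoc_castSucc, feedbackInput_snoc_last, Fin.snoc_castSucc,
    Fin.snoc_last]

theorem sum_outLaw (α : ℝ) {n : ℕ} (f : Encoder n) : ∑ y, outLaw α f y = 1 := by
  induction n with
  | zero => simp [outLaw]
  | succ n ih =>
    rw [sum_snoc]
    simp only [outLaw_snoc, ← Finset.mul_sum, sum_bec, mul_one]
    exact ih _

/-! ### Converse -/

/-- Sum over the blocks of two outputs of the score `s`. -/
def blockScore (s : Output → Output → ℝ) {k : ℕ} (y : Fin (2 * k) → Output) : ℝ :=
  ∑ j : Fin k, s (y ⟨2 * j, by omega⟩) (y ⟨2 * j + 1, by omega⟩)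

/-- Product over the blocks of two outputs of the reference law `Q`. -/
def blockLaw (Q : Output → Output → ℝ) {k : ℕ} (y : Fin (2 * k) → Output) : ℝ :=
  ∏ j : Fin k, Q (y ⟨2 * j, by omega⟩) (y ⟨2 * j + 1, by omega⟩)

/-- All strategies `(x₁, y₁ ↦ x₂)` that the encoder uses in blocks of two satisfy `S`. -/
def Encoder.Blockwise {n : ℕ} (f : Encoder n) (S : Fin 2 → (Output → Fin 2) → Prop) : Prop :=
  ∀ (j : ℕ) (h : 2 * j + 1 < n) (y : Fin (2 * j) → Output),
    S (f ⟨2 * j, by omega⟩ y) (fun b => f ⟨2 * j + 1, h⟩ (Fin.snoc (α := fun _ => Output) y b))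

/-- The sequence `y` followed by two further outputs. -/
def snocTwo {k : ℕ} (y : Fin (2 * k) → Output) (b c : Output) : Fin (2 * (k + 1)) → Output :=
  Fin.snoc (α := fun _ => Output) (n := 2 * k + 1) (Fin.snoc (α := fun _ => Output) y b) c

theorem snocTwo_of_lt {k : ℕ} (y : Fin (2 * k) → Output) (b c : Output) (i : ℕ) (h : i < 2 * k) :
    snocTwo y b c ⟨i, by omega⟩ = y ⟨i, h⟩ := by
  have h2 : i < 2 * k + 1 := by omega
  simp [snocTwo, Fin.snoc, h, h2]

theorem snocTwo_fst {k : ℕ} (y : Fin (2 * k) → Output) (b c : Output) :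
    snocTwo y b c ⟨2 * k, by omega⟩ = b := by
  simp [snocTwo, Fin.snoc]

theorem snocTwo_snd {k : ℕ} (y : Fin (2 * k) → Output) (b c : Output) :
    snocTwo y b c ⟨2 * k + 1, by omega⟩ = c := by
  simp [snocTwo, Fin.snoc]

theorem sum_snocTwo {k : ℕ} (F : (Fin (2 * (k + 1)) → Output) → ℝ) :
    ∑ z, F z = ∑ y : Fin (2 * k) → Output, ∑ b, ∑ c, F (snocTwo y b c) := by
  exact (sum_snoc (n := 2 * k + 1) F).trans (sum_snoc (n := 2 * k) _)

theorem blockScore_snocTwo (s : Output → Output → ℝ) {k : ℕ} (y : Fin (2 * k) → Output)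
    (b c : Output) : blockScore s (snocTwo y b c) = blockScore s y + s b c := by
  unfold blockScore
  rw [Fin.sum_univ_castSucc]
  congr 1
  · refine Finset.sum_congr rfl fun j _ => ?_
    congr 1 <;> exact snocTwo_of_lt y b c _ (by simp <;> omega)
  · simp only [Fin.val_last]
    rw [snocTwo_fst, snocTwo_snd]

theorem blockLaw_snocTwo (Q : Output → Output → ℝ) {k : ℕ} (y : Fin (2 * k) → Output)
    (b c : Output) : blockLaw Q (snocTwo y b c) = blockLaw Q y * Q b c := by
  unfold blockLaw
  rw [Fin.prod_univ_castSucc]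
  congr 1
  · refine Finset.prod_congr rfl fun j _ => ?_
    congr 1 <;> exact snocTwo_of_lt y b c _ (by simp <;> omega)
  · simp only [Fin.val_last]
    rw [snocTwo_fst, snocTwo_snd]

/-- The encoder without its last block. -/
def Encoder.initTwo {k : ℕ} (f : Encoder (2 * (k + 1))) : Encoder (2 * k) :=
  Encoder.init (n := 2 * k) (Encoder.init (n := 2 * k + 1) f)

theorem outLaw_snocTwo (α : ℝ) {k : ℕ} (f : Encoder (2 * (k + 1))) (y : Fin (2 * k) → Output)
    (b c : Output) :
    outLaw α f (snocTwo y b c) = outLaw α f.initTwo y *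
      (bec α (f ⟨2 * k, by omega⟩ y) b *
        bec α (f ⟨2 * k + 1, by omega⟩ (Fin.snoc (α := fun _ => Output) y b)) c) := by
  have h := outLaw_snoc α (n := 2 * k + 1) f (Fin.snoc (α := fun _ => Output) y b) c
  have h' := outLaw_snoc α (n := 2 * k) (Encoder.init (n := 2 * k + 1) f) y b
  exact h.trans ((congrArg (· * _) h').trans (mul_assoc _ _ _))

theorem Encoder.Blockwise.initTwo {k : ℕ} {f : Encoder (2 * (k + 1))}
    {S : Fin 2 → (Output → Fin 2) → Prop} (hf : f.Blockwise S) : f.initTwo.Blockwise S :=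
  fun j h y => hf j (by omega) y

theorem Encoder.Blockwise.last {k : ℕ} {f : Encoder (2 * (k + 1))}
    {S : Fin 2 → (Output → Fin 2) → Prop} (hf : f.Blockwise S) (y : Fin (2 * k) → Output) :
    S (f ⟨2 * k, by omega⟩ y)
      (fun b => f ⟨2 * k + 1, by omega⟩ (Fin.snoc (α := fun _ => Output) y b)) :=
  hf k (by omega) y

/-- Conditionally on the past outputs, the encoder plays a single strategy in the last block, whose
mean score is at most `K`. The tower property adds these bounds up, although the blocks are
dependent. -/
theorem sum_outLaw_mul_blockScore_le {α K : ℝ} (h0 : 0 ≤ α) (h1 : α ≤ 1)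
    {s : Output → Output → ℝ} {k : ℕ} (f : Encoder (2 * k))
    (hf : f.Blockwise fun x g => ∑ b, ∑ c, bec α x b * bec α (g b) c * s b c ≤ K) :
    ∑ y, outLaw α f y * blockScore s y ≤ k * K := by
  induction k with
  | zero => simp [blockScore]
  | succ k ih =>
    rw [sum_snocTwo]
    have hy : ∀ y : Fin (2 * k) → Output,
        ∑ b, ∑ c, outLaw α f (snocTwo y b c) * blockScore s (snocTwo y b c) ≤
          outLaw α f.initTwo y * blockScore s y + outLaw α f.initTwo y * K := by
      intro y
      have hl := hf.last y
      have hone : ∑ b, ∑ c, (bec α (f ⟨2 * k, by omega⟩ y) b *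
          bec α (f ⟨2 * k + 1, by omega⟩ (Fin.snoc (α := fun _ => Output) y b)) c) = 1 := by
        simp only [← Finset.mul_sum, sum_bec, mul_one]
      have e : ∑ b, ∑ c, outLaw α f (snocTwo y b c) * blockScore s (snocTwo y b c) =
          outLaw α f.initTwo y * (blockScore s y * (∑ b, ∑ c, (bec α (f ⟨2 * k, by omega⟩ y) b *
            bec α (f ⟨2 * k + 1, by omega⟩ (Fin.snoc (α := fun _ => Output) y b)) c)) +
          ∑ b, ∑ c, bec α (f ⟨2 * k, by omega⟩ y) b *
            bec α (f ⟨2 * k + 1, by omega⟩ (Fin.snoc (α := fun _ => Output) y b)) c * s b c) := by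
        simp only [outLaw_snocTwo, blockScore_snocTwo, Finset.mul_sum, mul_add,
          ← Finset.sum_add_distrib]
        refine Finset.sum_congr rfl fun b _ => Finset.sum_congr rfl fun c _ => ?_
        ring
      rw [e, hone, mul_one, mul_add]
      exact add_le_add le_rfl (mul_le_mul_of_nonneg_left hl (outLaw_nonneg h0 h1 _ _))
    refine (Finset.sum_le_sum fun y _ => hy y).trans ?_
    rw [Finset.sum_add_distrib, ← Finset.sum_mul, sum_outLaw]
    have := ih f.initTwo hf.initTwo
    push_cast
    linarith

theorem outLaw_le_blockLaw_mul_exp {α : ℝ} (h0 : 0 ≤ α) (h1 : α ≤ 1)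
    {s Q : Output → Output → ℝ} (hQ : ∀ b c, 0 ≤ Q b c) {k : ℕ} (f : Encoder (2 * k))
    (hf : f.Blockwise fun x g => ∀ b c, bec α x b * bec α (g b) c ≤ Q b c * Real.exp (s b c))
    (y : Fin (2 * k) → Output) :
    outLaw α f y ≤ blockLaw Q y * Real.exp (blockScore s y) := by
  induction k with
  | zero => simp [blockScore, blockLaw, outLaw]
  | succ k ih =>
    obtain ⟨z, b, c, rfl⟩ : ∃ z b c, y = snocTwo (k := k) z b c := by
      refine ⟨Fin.init (α := fun _ => Output) (n := 2 * k)
        (Fin.init (α := fun _ => Output) (n := 2 * k + 1) y),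
        (Fin.init (α := fun _ => Output) (n := 2 * k + 1) y) (Fin.last _),
        y (Fin.last (2 * k + 1)), ?_⟩
      unfold snocTwo
      rw [Fin.snoc_init_self]
      exact (Fin.snoc_init_self (α := fun _ => Output) (n := 2 * k + 1) y).symm
    rw [outLaw_snocTwo, blockLaw_snocTwo, blockScore_snocTwo, Real.exp_add]
    calc _ ≤ (blockLaw Q z * Real.exp (blockScore s z)) * (Q b c * Real.exp (s b c)) := by
          refine mul_le_mul (ih f.initTwo hf.initTwo z) (hf.last z b c)
            (mul_nonneg (bec_nonneg h0 h1 _ _) (bec_nonneg h0 h1 _ _)) ?_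
          exact mul_nonneg (Finset.prod_nonneg fun _ _ => hQ _ _) (Real.exp_nonneg _)
      _ = _ := by ring

theorem sum_blockLaw {Q : Output → Output → ℝ} (hQ : ∑ b, ∑ c, Q b c = 1) (k : ℕ) :
    ∑ y : Fin (2 * k) → Output, blockLaw Q y = 1 := by
  induction k with
  | zero => simp [blockLaw]
  | succ k ih =>
    rw [sum_snocTwo]
    simp only [blockLaw_snocTwo, ← Finset.mul_sum, hQ, mul_one]
    exact ih

/-- A reference output law `Q` with score `s` for a block of two channel uses: on each strategy,
the likelihood ratio to `Q` is at most `exp s`, and the score has mean at most `K`. -/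
def BlockBound (α K : ℝ) (s Q : Output → Output → ℝ) (x : Fin 2) (g : Output → Fin 2) : Prop :=
  ∑ b, ∑ c, bec α x b * bec α (g b) c * s b c ≤ K ∧
    ∀ b c, bec α x b * bec α (g b) c ≤ Q b c * Real.exp (s b c)

/-- Change of measure to the reference law on the event `D`. -/
theorem sum_ite_outLaw_mul_log_le {α K : ℝ} (h0 : 0 ≤ α) (h1 : α ≤ 1)
    {s Q : Output → Output → ℝ} (hQ : ∀ b c, 0 ≤ Q b c) (hQ1 : ∑ b, ∑ c, Q b c = 1)
    {k : ℕ} (f : Encoder (2 * k)) (hf : f.Blockwise (BlockBound α K s Q))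
    (D : (Fin (2 * k) → Output) → Prop) [DecidablePred D] {M : ℝ} (hM : 1 ≤ M) :
    (∑ y, if D y then outLaw α f y else 0) * Real.log M ≤
      k * K + M * ∑ y, if D y then blockLaw Q y else 0 := by
  have hs := sum_outLaw_mul_blockScore_le h0 h1 f (fun j h y => (hf j h y).1)
  have hd := outLaw_le_blockLaw_mul_exp h0 h1 hQ f (fun j h y => (hf j h y).2)
  have hpt : ∀ y, outLaw α f y + (if D y then outLaw α f y else 0) * Real.log M -
      outLaw α f y * blockScore s y ≤
        blockLaw Q y + M * (if D y then blockLaw Q y else 0) := by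
    intro y
    have hQy : 0 ≤ blockLaw Q y := Finset.prod_nonneg fun _ _ => hQ _ _
    have hP := outLaw_nonneg h0 h1 f y
    -- From `1 + u ≤ exp u` at `u = t - score`. The choice is `t = log M` on `D` and `t = 0` off
    -- `D`; after summation the `1` cancels against the total mass of `Q`.
    have key : ∀ t : ℝ, outLaw α f y * (1 + t - blockScore s y) ≤ blockLaw Q y * Real.exp t := by
      intro t
      calc _ ≤ outLaw α f y * Real.exp (t - blockScore s y) := by
            refine mul_le_mul_of_nonneg_left ?_ hP
            have := Real.add_one_le_exp (t - blockScore s y)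
            linarith
        _ ≤ blockLaw Q y * Real.exp (blockScore s y) * Real.exp (t - blockScore s y) :=
            mul_le_mul_of_nonneg_right (hd y) (Real.exp_nonneg _)
        _ = _ := by rw [mul_assoc, ← Real.exp_add]; congr 2; ring
    split_ifs
    · have := key (Real.log M)
      rw [Real.exp_log (by linarith)] at this
      linarith
    · have := key 0
      rw [Real.exp_zero] at this
      linarith
  have hsum := Finset.sum_le_sum fun y (_ : y ∈ Finset.univ) => hpt y
  rw [Finset.sum_sub_distrib, Finset.sum_add_distrib, Finset.sum_add_distrib, sum_outLaw,
    sum_blockLaw hQ1, ← Finset.sum_mul, ← Finset.mul_sum] at hsum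
  linarith

/-- Takes the place of Fano's inequality. The decoding sets partition the output sequences, so their
reference masses sum to `1`, and averaging the change of measure over messages leaves the additive
constant `1`. -/
theorem one_sub_errorProb_mul_log_le {α K : ℝ} (h0 : 0 ≤ α) (h1 : α ≤ 1)
    {s Q : Output → Output → ℝ} (hQ : ∀ b c, 0 ≤ Q b c) (hQ1 : ∑ b, ∑ c, Q b c = 1)
    {k M : ℕ} (hM : 1 ≤ M) (c : FeedbackCode M (2 * k))
    (hc : ∀ w, Encoder.Blockwise (c.enc w) (BlockBound α K s Q)) :
    (1 - c.errorProb α) * Real.log M ≤ k * K + 1 := by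
  have hM' : (1 : ℝ) ≤ M := by exact_mod_cast hM
  have hM0 : (M : ℝ) ≠ 0 := by positivity
  have hw : ∀ w, (∑ y, if c.dec y = w then outLaw α (c.enc w) y else 0) * Real.log M ≤
      k * K + M * ∑ y, if c.dec y = w then blockLaw Q y else 0 := fun w =>
    sum_ite_outLaw_mul_log_le h0 h1 hQ hQ1 (c.enc w) (hc w) (fun y => c.dec y = w) hM'
  have hsum := Finset.sum_le_sum fun w (_ : w ∈ Finset.univ) => hw w
  rw [Finset.sum_add_distrib, ← Finset.sum_mul, Finset.sum_const,
    Finset.card_univ, Fintype.card_fin, nsmul_eq_mul,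
    ← Finset.mul_sum, Finset.sum_comm (f := fun w y => if c.dec y = w then blockLaw Q y else 0)] at hsum
  simp only [Finset.sum_ite_eq, Finset.mem_univ, if_true] at hsum
  rw [sum_blockLaw hQ1] at hsum
  have he : c.errorProb α = 1 - (1 / (M : ℝ)) *
      ∑ w, ∑ y, if c.dec y = w then outLaw α (c.enc w) y else 0 := by
    have : ∑ w : Fin M, ∑ y, (if c.dec y ≠ w then outLaw α (c.enc w) y else 0) =
        M - ∑ w, ∑ y, if c.dec y = w then outLaw α (c.enc w) y else 0 := by
      rw [eq_sub_iff_add_eq, ← Finset.sum_add_distrib]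
      simp only [← Finset.sum_add_distrib]
      have : ∀ (w : Fin M) y, (if c.dec y ≠ w then outLaw α (c.enc w) y else 0) +
          (if c.dec y = w then outLaw α (c.enc w) y else 0) = outLaw α (c.enc w) y := by
        intro w y
        by_cases h : c.dec y = w <;> simp [h]
      simp only [this, sum_outLaw]
      simp
    change (1 / (M : ℝ)) * ∑ w : Fin M, ∑ y, (if c.dec y ≠ w then outLaw α (c.enc w) y else 0) = _
    rw [this, mul_sub, one_div, inv_mul_cancel₀ hM0]
  rw [he, sub_sub_cancel, mul_assoc, one_div, inv_mul_le_iff₀ (by positivity)]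
  linarith

theorem rate_le_of_blockBound {α K R : ℝ} (h0 : 0 ≤ α) (h1 : α ≤ 1)
    {s Q : Output → Output → ℝ} (hQ : ∀ b c, 0 ≤ Q b c) (hQ1 : ∑ b, ∑ c, Q b c = 1)
    (c : (n : ℕ) → FeedbackCode ⌈(2 : ℝ) ^ ((n : ℝ) * R)⌉₊ n)
    (hc : ∀ n w, Encoder.Blockwise ((c n).enc w) (BlockBound α K s Q))
    (hlim : Tendsto (fun n => (c n).errorProb α) atTop (𝓝 0)) :
    R ≤ K / (2 * Real.log 2) := by
  have hlog2 : 0 < Real.log 2 := Real.log_pos (by norm_num)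
  have hpos : ∀ k : ℕ, (0 : ℝ) < (2 : ℝ) ^ (((2 * k : ℕ) : ℝ) * R) := fun k => by positivity
  -- The even lengths, which consist of whole blocks, already bound the rate.
  have hlim2 : Tendsto (fun k : ℕ => (c (2 * k)).errorProb α) atTop (𝓝 0) :=
    hlim.comp (tendsto_id.const_mul_atTop' (by norm_num : 0 < 2))
  have hleft : Tendsto (fun k : ℕ => (1 - (c (2 * k)).errorProb α) * (2 * Real.log 2 * R)) atTop
      (𝓝 ((1 - 0) * (2 * Real.log 2 * R))) := (hlim2.const_sub 1).mul_const _
  have hright : Tendsto (fun k : ℕ => K + 1 / (k : ℝ)) atTop (𝓝 (K + 0)) :=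
    tendsto_one_div_atTop_nhds_zero_nat.const_add K
  have hle : ∀ᶠ k : ℕ in atTop,
      (1 - (c (2 * k)).errorProb α) * (2 * Real.log 2 * R) ≤ K + 1 / (k : ℝ) := by
    filter_upwards [eventually_gt_atTop 0, hlim2.eventually (gt_mem_nhds one_pos)] with k hk he
    have hk' : (0 : ℝ) < k := by exact_mod_cast hk
    have h := one_sub_errorProb_mul_log_le h0 h1 hQ hQ1 (Nat.ceil_pos.mpr (hpos k)) (c (2 * k))
      (hc _)
    have hlog : (k : ℝ) * (2 * Real.log 2 * R) ≤
        Real.log (⌈(2 : ℝ) ^ (((2 * k : ℕ) : ℝ) * R)⌉₊ : ℝ) := by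
      have := Real.log_le_log (hpos k) (Nat.le_ceil _)
      rw [Real.log_rpow (by norm_num)] at this
      refine le_trans (le_of_eq ?_) this
      push_cast
      ring
    have h2 := (mul_le_mul_of_nonneg_left hlog (by linarith :
      0 ≤ 1 - (c (2 * k)).errorProb α)).trans h
    rw [show K + 1 / (k : ℝ) = (k * K + 1) / k by field_simp, le_div_iff₀ hk']
    linarith
  have := le_of_tendsto_of_tendsto hleft hright hle
  rw [le_div_iff₀ (by positivity)]
  linarith

/-- The feedback code that ignores the feedback. -/
def Code.toFeedback {M n : ℕ} (c : Code M n) : FeedbackCode M n where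
  enc w i _ := c.enc w i
  dec := c.dec
  feasible w _ := c.feasible w

theorem FeedbackCode.block_feasible {M n : ℕ} (c : FeedbackCode M n) (w : Fin M) :
    Encoder.Blockwise (c.enc w) fun x g => x = 0 ∨ ∀ b, g b = 0 := by
  intro j h y
  by_contra hcon
  simp only [not_or, not_forall] at hcon
  obtain ⟨hx, b, hb⟩ := hcon
  -- Feasibility holds along every output sequence, so it may be tested on one that continues `y` by
  -- `b`. The entries after index `2 * j` do not influence the two inputs of block `j`.
  let z : Fin n → Output := fun i => if hi : (i : ℕ) < 2 * j then y ⟨i, hi⟩ else b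
  have hz := (energyFeasible_iff _).mp (c.feasible w z) j h
  have e1 : feedbackInput (c.enc w) z ⟨2 * j, by omega⟩ = c.enc w ⟨2 * j, by omega⟩ y := by
    unfold feedbackInput
    congr 1
    funext i
    have : (i : ℕ) < 2 * j := i.isLt
    simp [z, this]
  have e2 : feedbackInput (c.enc w) z ⟨2 * j + 1, h⟩ =
      c.enc w ⟨2 * j + 1, h⟩ (Fin.snoc (α := fun _ => Output) y b) := by
    unfold feedbackInput
    congr 1
  rw [e1, e2] at hz
  exact hz.elim hx hb

/-! ### Feinstein's lemma and the coding theorem for block channels -/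

theorem exists_le_of_le_weighted_sum {X : Type} [Fintype X] {p : X → ℝ} (hp : ∀ x, 0 ≤ p x)
    (hp1 : ∑ x, p x = 1) {f : X → ℝ} {t : ℝ} (h : t ≤ ∑ x, p x * f x) : ∃ x, t ≤ f x := by
  have : Nonempty X := by
    by_contra hX
    rw [not_nonempty_iff] at hX
    simp at hp1
  obtain ⟨x, hx⟩ := Finite.exists_max f
  refine ⟨x, h.trans ?_⟩
  calc ∑ y, p y * f y ≤ ∑ y, p y * f x :=
        Finset.sum_le_sum fun y _ => mul_le_mul_of_nonneg_left (hx y) (hp y)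
    _ = f x := by rw [← Finset.sum_mul, hp1, one_mul]

/-- Greedy choice. The decoding sets chosen so far have a union `E` of output mass at most `M * β`,
so deleting `E` from `A x` costs at most that much on average over `x`; some `x` does at least as
well as the average. Indexing by `ℕ` lets the induction extend by `Function.update`. -/
theorem feinstein {X Y : Type} [Fintype X] [Fintype Y] [DecidableEq Y] {p : X → ℝ}
    (hp : ∀ x, 0 ≤ p x) (hp1 : ∑ x, p x = 1) {W : X → Y → ℝ} (hW : ∀ x y, 0 ≤ W x y)
    (A : X → Finset Y) {β δ : ℝ} (hβ : 0 ≤ β) (hA : ∀ x, ∑ y ∈ A x, ∑ x', p x' * W x' y ≤ β)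
    (hδ : 1 - δ ≤ ∑ x, p x * ∑ y ∈ A x, W x y) (M m : ℕ) (hm : m ≤ M) :
    ∃ (c : ℕ → X) (D : ℕ → Finset Y),
      (∀ i < m, ∀ j < m, i ≠ j → Disjoint (D i) (D j)) ∧
      (∀ i < m, D i ⊆ A (c i)) ∧
      ∀ i < m, 1 - (δ + M * β) ≤ ∑ y ∈ D i, W (c i) y := by
  induction m with
  | zero =>
    obtain ⟨x, -⟩ := exists_le_of_le_weighted_sum hp hp1 hδ
    exact ⟨fun _ => x, fun _ => ∅, by simp, by simp, by simp⟩
  | succ m ih =>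
    obtain ⟨c, D, hdisj, hsub, hbound⟩ := ih (by omega)
    set E := (Finset.range m).biUnion D with hE
    have hq : ∀ y, 0 ≤ ∑ x', p x' * W x' y := fun y =>
      Finset.sum_nonneg fun x' _ => mul_nonneg (hp x') (hW x' y)
    have hEq : ∑ y ∈ E, ∑ x', p x' * W x' y ≤ M * β := by
      calc ∑ y ∈ E, ∑ x', p x' * W x' y
          = ∑ i ∈ Finset.range m, ∑ y ∈ D i, ∑ x', p x' * W x' y := by
            refine Finset.sum_biUnion fun i hi j hj hij => ?_
            exact hdisj i (by simpa using hi) j (by simpa using hj) hij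
        _ ≤ ∑ i ∈ Finset.range m, β := by
            refine Finset.sum_le_sum fun i hi => le_trans ?_ (hA (c i))
            exact Finset.sum_le_sum_of_subset_of_nonneg (hsub i (Finset.mem_range.mp hi))
              fun y _ _ => hq y
        _ = m * β := by simp
        _ ≤ M * β := by
            refine mul_le_mul_of_nonneg_right ?_ hβ
            exact_mod_cast (by omega : m ≤ M)
    obtain ⟨x, hx⟩ : ∃ x, 1 - (δ + M * β) ≤ ∑ y ∈ A x \ E, W x y := by
      refine exists_le_of_le_weighted_sum hp hp1 ?_
      have hsplit : ∀ x, ∑ y ∈ A x, W x y ≤ ∑ y ∈ A x \ E, W x y + ∑ y ∈ E, W x y := by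
        intro x
        rw [← Finset.sum_inter_add_sum_sdiff (A x) E, add_comm]
        refine add_le_add le_rfl ?_
        exact Finset.sum_le_sum_of_subset_of_nonneg Finset.inter_subset_right
          fun y _ _ => hW x y
      have h1 : ∑ x, p x * ∑ y ∈ A x, W x y ≤
          ∑ x, (p x * ∑ y ∈ A x \ E, W x y + p x * ∑ y ∈ E, W x y) := by
        refine Finset.sum_le_sum fun x _ => ?_
        rw [← mul_add]
        exact mul_le_mul_of_nonneg_left (hsplit x) (hp x)
      have h2 : ∑ x, p x * ∑ y ∈ E, W x y = ∑ y ∈ E, ∑ x', p x' * W x' y := by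
        simp only [Finset.mul_sum]
        exact Finset.sum_comm
      rw [Finset.sum_add_distrib, h2] at h1
      linarith
    refine ⟨Function.update c m x, Function.update D m (A x \ E), ?_, ?_, ?_⟩
    · have hnew : ∀ i < m, Disjoint (D i) (A x \ E) := fun i hi =>
        Finset.disjoint_sdiff.mono_left
          (Finset.subset_biUnion_of_mem D (Finset.mem_range.mpr hi))
      intro i hi j hj hij
      rcases Nat.lt_succ_iff_lt_or_eq.mp hi with hi' | rfl <;>
        rcases Nat.lt_succ_iff_lt_or_eq.mp hj with hj' | rfl
      · rw [Function.update_of_ne hi'.ne, Function.update_of_ne hj'.ne]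
        exact hdisj i hi' j hj' hij
      · rw [Function.update_of_ne hi'.ne, Function.update_self]
        exact hnew i hi'
      · rw [Function.update_of_ne hj'.ne, Function.update_self]
        exact (hnew j hj').symm
      · exact absurd rfl hij
    · intro i hi
      rcases Nat.lt_succ_iff_lt_or_eq.mp hi with hi' | rfl
      · rw [Function.update_of_ne hi'.ne, Function.update_of_ne hi'.ne]
        exact hsub i hi'
      · rw [Function.update_self, Function.update_self]
        exact Finset.sdiff_subset
    · intro i hi
      rcases Nat.lt_succ_iff_lt_or_eq.mp hi with hi' | rfl
      · rw [Function.update_of_ne hi'.ne, Function.update_of_ne hi'.ne]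
        exact hbound i hi'
      · rw [Function.update_self, Function.update_self]
        exact hx

theorem exists_code_of_feinstein {X Y : Type} [Fintype X] [Fintype Y] [DecidableEq Y] {p : X → ℝ}
    (hp : ∀ x, 0 ≤ p x) (hp1 : ∑ x, p x = 1) {W : X → Y → ℝ} (hW : ∀ x y, 0 ≤ W x y)
    (hW1 : ∀ x, ∑ y, W x y = 1)
    (A : X → Finset Y) {β δ : ℝ} (hβ : 0 ≤ β) (hA : ∀ x, ∑ y ∈ A x, ∑ x', p x' * W x' y ≤ β)
    (hδ : 1 - δ ≤ ∑ x, p x * ∑ y ∈ A x, W x y) {M : ℕ} (hM : 0 < M) :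
    ∃ (c : Fin M → X) (d : Y → Fin M),
      ∀ w, ∑ y, (if d y ≠ w then W (c w) y else 0) ≤ δ + M * β := by
  obtain ⟨c, D, hdisj, -, hbound⟩ := feinstein hp hp1 hW A hβ hA hδ M M le_rfl
  classical
  -- Outputs outside all decoding sets go to an arbitrary message; the bound treats them as errors
  -- anyway.
  refine ⟨fun w => c w, fun y => if h : ∃ w : Fin M, y ∈ D w then h.choose else ⟨0, hM⟩, ?_⟩
  intro w
  have hd : ∀ y ∈ D w, (if h : ∃ w : Fin M, y ∈ D w then h.choose else ⟨0, hM⟩) = w := by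
    intro y hy
    have h : ∃ w : Fin M, y ∈ D w := ⟨w, hy⟩
    rw [dif_pos h]
    by_contra hne
    have := hdisj h.choose h.choose.isLt w w.isLt (fun he => hne (Fin.ext he))
    exact Finset.disjoint_left.mp this h.choose_spec hy
  have hle : ∀ y, (if (if h : ∃ w : Fin M, y ∈ D w then h.choose else ⟨0, hM⟩) ≠ w
      then W (c w) y else 0) ≤ W (c w) y - if y ∈ D w then W (c w) y else 0 := by
    intro y
    by_cases hy : y ∈ D w
    · simp [hd y hy, hy]
    · rw [if_neg hy, sub_zero]
      split_ifs
      · exact le_rfl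
      · exact hW _ _
      · exact le_rfl
      · exact hW _ _
  refine (Finset.sum_le_sum fun y _ => hle y).trans ?_
  rw [Finset.sum_sub_distrib, hW1, Finset.sum_ite_mem, Finset.univ_inter]
  have := hbound w w.isLt
  linarith

theorem sum_pi_prod {k : ℕ} {A : Type} [Fintype A] (F : Fin k → A → ℝ) :
    ∑ x : Fin k → A, ∏ j, F j (x j) = ∏ j, ∑ a, F j a := by
  rw [Finset.prod_univ_sum, Fintype.piFinset_univ]

/-- The moment equals `1` at `t = 0` and has derivative `-E f < 0` there. This is made explicit by
`exp u ≤ 1 + u + u ^ 2` for `|u| ≤ 1`. -/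
theorem exists_exp_moment_lt_one {Ω : Type} [Fintype Ω] {P : Ω → ℝ} (hP : ∀ ω, 0 ≤ P ω)
    (hP1 : ∑ ω, P ω = 1) {f : Ω → ℝ} (hf : 0 < ∑ ω, P ω * f ω) :
    ∃ t, 0 < t ∧ ∑ ω, P ω * Real.exp (-(t * f ω)) < 1 := by
  set d := ∑ ω, P ω * f ω with hd
  set B := ∑ ω, P ω * f ω ^ 2 with hB
  set C := ∑ ω, |f ω| with hC
  have hB0 : 0 ≤ B := Finset.sum_nonneg fun ω _ => mul_nonneg (hP ω) (sq_nonneg _)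
  have hC0 : 0 ≤ C := Finset.sum_nonneg fun ω _ => abs_nonneg _
  -- The first bound ensures `|t * f| ≤ 1`; the second makes the quadratic term smaller than the
  -- linear gain. The `+ 1` keeps the denominators positive.
  refine ⟨min (1 / (C + 1)) (d / (B + 1)), by positivity, ?_⟩
  set t := min (1 / (C + 1)) (d / (B + 1)) with ht
  have ht0 : 0 < t := by positivity
  have htC : t * C ≤ 1 := by
    have : t * (C + 1) ≤ 1 := by
      rw [← le_div_iff₀ (by positivity)]
      exact min_le_left _ _
    linarith
  have htB : t * B < d := by
    have : t * (B + 1) ≤ d := by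
      rw [← le_div_iff₀ (by positivity)]
      exact min_le_right _ _
    linarith
  have hpt : ∀ ω, P ω * Real.exp (-(t * f ω)) ≤
      P ω - t * (P ω * f ω) + t ^ 2 * (P ω * f ω ^ 2) := by
    intro ω
    have h1 : |-(t * f ω)| ≤ 1 := by
      rw [abs_neg, abs_mul, abs_of_pos ht0]
      refine le_trans (mul_le_mul_of_nonneg_left ?_ ht0.le) htC
      exact Finset.single_le_sum (f := fun ω => |f ω|) (fun ω _ => abs_nonneg _)
        (Finset.mem_univ ω)
    have h2 := (abs_le.mp (Real.abs_exp_sub_one_sub_id_le h1)).2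
    have h3 : Real.exp (-(t * f ω)) ≤ 1 - t * f ω + t ^ 2 * f ω ^ 2 := by
      rw [neg_sq, mul_pow] at h2
      linarith
    refine (mul_le_mul_of_nonneg_left h3 (hP ω)).trans (le_of_eq ?_)
    ring
  have hsum := Finset.sum_le_sum fun ω (_ : ω ∈ Finset.univ) => hpt ω
  rw [Finset.sum_add_distrib, Finset.sum_sub_distrib, hP1, ← Finset.mul_sum, ← Finset.mul_sum,
    ← hd, ← hB] at hsum
  have : t ^ 2 * B < t * d := by
    rw [sq, mul_assoc]
    exact mul_lt_mul_of_pos_left htB ht0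
  linarith

/-- Codes for `k` uses of the memoryless channel `W`, from an input law `p` and a lower bound `s`
on the information density. -/
theorem exists_block_code {U V : Type} [Fintype U] [Fintype V] [DecidableEq V]
    {p : U → ℝ} (hp : ∀ u, 0 ≤ p u) (hp1 : ∑ u, p u = 1) {W : U → V → ℝ}
    (hW : ∀ u v, 0 ≤ W u v) (hW1 : ∀ u, ∑ v, W u v = 1) {s : U → V → ℝ}
    (hs : ∀ u v, W u v ≠ 0 → (∑ u', p u' * W u' v) * Real.exp (s u v) ≤ W u v) {γ : ℝ}
    (hγ : γ < ∑ u, ∑ v, p u * W u v * s u v) :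
    ∃ ρ : ℝ, 0 ≤ ρ ∧ ρ < 1 ∧ ∀ k M : ℕ, 0 < M →
      ∃ (c : Fin M → Fin k → U) (d : (Fin k → V) → Fin M), ∀ w,
        ∑ y, (if d y ≠ w then ∏ j, W (c w j) (y j) else 0) ≤
          ρ ^ k + M * Real.exp (-(k * γ)) := by
  have hP1 : ∑ ω : U × V, p ω.1 * W ω.1 ω.2 = 1 := by
    simp only [Fintype.sum_prod_type, ← Finset.mul_sum, hW1, mul_one, hp1]
  have hP0 : ∀ ω : U × V, 0 ≤ p ω.1 * W ω.1 ω.2 := fun ω => mul_nonneg (hp _) (hW _ _)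
  have hmean : 0 < ∑ ω : U × V, p ω.1 * W ω.1 ω.2 * (s ω.1 ω.2 - γ) := by
    simp only [mul_sub]
    rw [Finset.sum_sub_distrib, ← Finset.sum_mul, hP1, Fintype.sum_prod_type]
    linarith
  obtain ⟨t, ht0, ht⟩ := exists_exp_moment_lt_one hP0 hP1 hmean
  refine ⟨_, Finset.sum_nonneg fun ω _ => mul_nonneg (hP0 ω) (Real.exp_nonneg _), ht, ?_⟩
  intro k M hM
  classical
  -- Outputs reachable from `x` whose total density is at least `k * γ`. Reachability is required
  -- because `hs` bounds the density only where `W` is nonzero.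
  set A : (Fin k → U) → Finset (Fin k → V) := fun x =>
    {y | ∏ j, W (x j) (y j) ≠ 0 ∧ k * γ ≤ ∑ j, s (x j) (y j)} with hAdef
  have hWk0 : ∀ (x : Fin k → U) (y : Fin k → V), 0 ≤ ∏ j, W (x j) (y j) := fun x y =>
    Finset.prod_nonneg fun j _ => hW _ _
  have hWk1 : ∀ x : Fin k → U, ∑ y : Fin k → V, ∏ j, W (x j) (y j) = 1 := fun x => by
    rw [sum_pi_prod (fun j v => W (x j) v)]
    simp [hW1]
  have hpk0 : ∀ x : Fin k → U, 0 ≤ ∏ j, p (x j) := fun x => Finset.prod_nonneg fun j _ => hp _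
  refine exists_code_of_feinstein (p := fun x : Fin k → U => ∏ j, p (x j))
    (W := fun x y => ∏ j, W (x j) (y j)) hpk0 ?_ hWk0 hWk1 A (Real.exp_nonneg _) ?_ ?_ hM
  · rw [sum_pi_prod (fun _ u => p u)]
    simp [hp1]
  · intro x
    have hpt : ∀ y ∈ A x, ∑ x' : Fin k → U, (∏ j, p (x' j)) * ∏ j, W (x' j) (y j) ≤
        Real.exp (-(k * γ)) * ∏ j, W (x j) (y j) := by
      intro y hy
      rw [hAdef, Finset.mem_filter] at hy
      obtain ⟨-, hne, hge⟩ := hy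
      have hq : ∑ x' : Fin k → U, (∏ j, p (x' j)) * ∏ j, W (x' j) (y j) =
          ∏ j, ∑ u, p u * W u (y j) := by
        simp only [← Finset.prod_mul_distrib]
        exact sum_pi_prod (fun j u => p u * W u (y j))
      have hq0 : ∀ j, 0 ≤ ∑ u, p u * W u (y j) := fun j =>
        Finset.sum_nonneg fun u _ => mul_nonneg (hp u) (hW u _)
      have h1 : (∏ j, ∑ u, p u * W u (y j)) * Real.exp (∑ j, s (x j) (y j)) ≤
          ∏ j, W (x j) (y j) := by
        rw [Real.exp_sum, ← Finset.prod_mul_distrib]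
        refine Finset.prod_le_prod (fun j _ => mul_nonneg (hq0 j) (Real.exp_nonneg _)) ?_
        exact fun j _ => hs _ _ (Finset.prod_ne_zero_iff.mp hne j (Finset.mem_univ j))
      have h2 : (∏ j, ∑ u, p u * W u (y j)) * Real.exp (k * γ) ≤ ∏ j, W (x j) (y j) :=
        (mul_le_mul_of_nonneg_left (Real.exp_le_exp.mpr hge)
          (Finset.prod_nonneg fun j _ => hq0 j)).trans h1
      rw [hq, Real.exp_neg, inv_mul_eq_div, le_div_iff₀ (Real.exp_pos _)]
      exact h2
    refine (Finset.sum_le_sum hpt).trans ?_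
    rw [← Finset.mul_sum]
    refine mul_le_of_le_one_right (Real.exp_nonneg _) ?_
    rw [← hWk1 x]
    exact Finset.sum_le_sum_of_subset_of_nonneg (Finset.subset_univ _) fun y _ _ => hWk0 x y
  -- Chernoff bound in pointwise form: off `A x`, either the probability vanishes or the exponential
  -- factor is at least `1`. Summing over `y` and averaging over `x` gives mass at least `1 - ρ ^ k`
  -- to the sets `A x`.
  · have hpt : ∀ x y, (∏ j, W (x j) (y j)) - ∏ j, (W (x j) (y j) *
        Real.exp (-(t * (s (x j) (y j) - γ)))) ≤
          if y ∈ A x then ∏ j, W (x j) (y j) else 0 := by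
      intro x y
      rw [Finset.prod_mul_distrib, ← Real.exp_sum]
      split_ifs with hy
      · exact sub_le_self _ (mul_nonneg (hWk0 x y) (Real.exp_nonneg _))
      · by_cases h0 : ∏ j, W (x j) (y j) = 0
        · simp [h0]
        · have hlt : ∑ j, s (x j) (y j) < k * γ := by
            by_contra hcon
            exact hy (by simp [hAdef, h0, not_lt.mp hcon])
          rw [sub_nonpos]
          refine le_mul_of_one_le_right (hWk0 x y) (Real.one_le_exp ?_)
          rw [Finset.sum_neg_distrib, ← Finset.mul_sum, Finset.sum_sub_distrib]
          simp only [Finset.sum_const, Finset.card_univ, Fintype.card_fin, nsmul_eq_mul]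
          nlinarith
    have hx : ∀ x : Fin k → U, (∏ j, p (x j)) - ∏ j, (p (x j) * ∑ v, W (x j) v *
        Real.exp (-(t * (s (x j) v - γ)))) ≤
          (∏ j, p (x j)) * ∑ y ∈ A x, ∏ j, W (x j) (y j) := by
      intro x
      rw [Finset.prod_mul_distrib, ← sum_pi_prod (fun j v => W (x j) v *
        Real.exp (-(t * (s (x j) v - γ))))]
      have := Finset.sum_le_sum fun y (_ : y ∈ Finset.univ) => hpt x y
      rw [Finset.sum_sub_distrib, hWk1, Finset.sum_ite_mem, Finset.univ_inter] at this
      have := mul_le_mul_of_nonneg_left this (hpk0 x)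
      linarith
    refine le_trans (le_of_eq ?_) (Finset.sum_le_sum fun x _ => hx x)
    rw [Finset.sum_sub_distrib, sum_pi_prod (fun _ u => p u), sum_pi_prod
      (fun _ u => p u * ∑ v, W u v * Real.exp (-(t * (s u v - γ))))]
    simp [hp1, Fintype.sum_prod_type, Finset.mul_sum, mul_assoc]

/-! ### Feedback codes from block strategies -/

/-- The two outputs of each block. -/
def blockEquiv (k : ℕ) : (Fin (2 * k) → Output) ≃ (Fin k → Output × Output) where
  toFun y j := (y ⟨2 * j, by omega⟩, y ⟨2 * j + 1, by omega⟩)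
  invFun v i := if (i : ℕ) % 2 = 0 then (v ⟨i / 2, by omega⟩).1 else (v ⟨i / 2, by omega⟩).2
  left_inv y := by
    funext i
    dsimp only
    split_ifs <;> congr 1 <;> ext <;> dsimp only <;> omega
  right_inv v := by
    funext j
    have h1 : (2 * (j : ℕ)) / 2 = j := by omega
    have h2 : (2 * (j : ℕ) + 1) / 2 = j := by omega
    have h3 : (2 * (j : ℕ) + 1) % 2 = 1 := by omega
    simp [h2, h3]

/-- The encoder that uses the strategy `(x₁, y₁ ↦ x₂) = σ j` in block `j`. -/
def blockEncoder {k : ℕ} (σ : Fin k → Fin 2 × (Output → Fin 2)) : Encoder (2 * k) := fun i y =>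
  if h : (i : ℕ) % 2 = 0 then (σ ⟨i / 2, by omega⟩).1
  else (σ ⟨i / 2, by omega⟩).2 (y ⟨i - 1, by omega⟩)

theorem feedbackInput_blockEncoder_even {k : ℕ} (σ : Fin k → Fin 2 × (Output → Fin 2))
    (y : Fin (2 * k) → Output) (j : ℕ) (h : j < k) :
    feedbackInput (blockEncoder σ) y ⟨2 * j, by omega⟩ = (σ ⟨j, h⟩).1 := by
  simp [feedbackInput, blockEncoder]

theorem feedbackInput_blockEncoder_odd {k : ℕ} (σ : Fin k → Fin 2 × (Output → Fin 2))
    (y : Fin (2 * k) → Output) (j : ℕ) (h : j < k) :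
    feedbackInput (blockEncoder σ) y ⟨2 * j + 1, by omega⟩ =
      (σ ⟨j, h⟩).2 (y ⟨2 * j, by omega⟩) := by
  have h2 : (2 * j + 1) / 2 = j := by omega
  have h3 : (2 * j + 1) % 2 = 1 := by omega
  simp [feedbackInput, blockEncoder, h2, h3]

theorem prod_blocks {k : ℕ} (F : Fin (2 * k) → ℝ) :
    ∏ i, F i = ∏ j : Fin k, (F ⟨2 * j, by omega⟩ * F ⟨2 * j + 1, by omega⟩) := by
  induction k with
  | zero => simp
  | succ k ih =>
    rw [Fin.prod_univ_castSucc (n := k)]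
    refine (Fin.prod_univ_castSucc (n := 2 * k + 1) F).trans ?_
    rw [Fin.prod_univ_castSucc (n := 2 * k), ih, mul_assoc]
    rfl

/-- Transition probability of a block of two channel uses with a feedback strategy. -/
def blockBec (α : ℝ) (σ : Fin 2 × (Output → Fin 2)) (v : Output × Output) : ℝ :=
  bec α σ.1 v.1 * bec α (σ.2 v.1) v.2

theorem outLaw_blockEncoder (α : ℝ) {k : ℕ} (σ : Fin k → Fin 2 × (Output → Fin 2))
    (y : Fin (2 * k) → Output) :
    outLaw α (blockEncoder σ) y = ∏ j, blockBec α (σ j) (blockEquiv k y j) := by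
  unfold outLaw
  rw [prod_blocks]
  refine Finset.prod_congr rfl fun j _ => ?_
  rw [feedbackInput_blockEncoder_even σ y j j.isLt, feedbackInput_blockEncoder_odd σ y j j.isLt]
  rfl

/-- The feedback code with block strategies `σ w` and block decoder `d`. -/
def blockCode {k M : ℕ} (σ : Fin M → Fin k → Fin 2 × (Output → Fin 2))
    (hσ : ∀ w j, (σ w j).1 = 0 ∨ ∀ b, (σ w j).2 b = 0)
    (d : (Fin k → Output × Output) → Fin M) : FeedbackCode M (2 * k) where
  enc w := blockEncoder (σ w)
  dec y := d (blockEquiv k y)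
  feasible w y := by
    rw [energyFeasible_iff]
    intro i h
    rw [feedbackInput_blockEncoder_even _ y i (by omega),
      feedbackInput_blockEncoder_odd _ y i (by omega)]
    exact (hσ w ⟨i, by omega⟩).imp id fun hg => hg _

theorem blockCode_errorProb (α : ℝ) {k M : ℕ} (σ : Fin M → Fin k → Fin 2 × (Output → Fin 2))
    (hσ : ∀ w j, (σ w j).1 = 0 ∨ ∀ b, (σ w j).2 b = 0)
    (d : (Fin k → Output × Output) → Fin M) :
    (blockCode σ hσ d).errorProb α = (1 / (M : ℝ)) * ∑ w, ∑ v,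
      if d v ≠ w then ∏ j, blockBec α (σ w j) (v j) else 0 := by
  unfold FeedbackCode.errorProb
  congr 1
  refine Finset.sum_congr rfl fun w _ => ?_
  rw [← (blockEquiv k).sum_comp]
  refine Finset.sum_congr rfl fun y _ => ?_
  rw [← outLaw_blockEncoder]
  rfl

/-- The code followed by one more channel use with input `0`. -/
def FeedbackCode.extend {M n : ℕ} (c : FeedbackCode M n) : FeedbackCode M (n + 1) where
  enc w i y := if h : (i : ℕ) < n then c.enc w ⟨i, h⟩ y else 0
  dec y := c.dec (Fin.init (α := fun _ => Output) y)
  feasible w y := by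
    rw [energyFeasible_iff]
    intro i h
    by_cases hi : 2 * i + 1 < n
    · have h1 := (energyFeasible_iff _).mp
        (c.feasible w (Fin.init (α := fun _ => Output) y)) i hi
      have h2 : 2 * i < n := by omega
      simp only [feedbackInput, hi, h2, dif_pos]
      exact h1
    -- Here `2 * i + 1 = n`: the appended symbol completes a block, and it is `0`.
    · right
      simp [feedbackInput, hi]

theorem FeedbackCode.extend_errorProb {M n : ℕ} (c : FeedbackCode M n) (α : ℝ) :
    c.extend.errorProb α = c.errorProb α := by
  unfold FeedbackCode.errorProb
  congr 1
  refine Finset.sum_congr rfl fun w _ => ?_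
  rw [sum_snoc]
  refine Finset.sum_congr rfl fun y _ => ?_
  have hdec : ∀ b, c.extend.dec (Fin.snoc (α := fun _ => Output) y b) = c.dec y := by
    intro b
    simp [FeedbackCode.extend]
  have hinit : Encoder.init (c.extend.enc w) = c.enc w := by
    funext i z
    simp [Encoder.init, FeedbackCode.extend]
  have hlaw : ∀ b, (∏ i, bec α (feedbackInput (c.extend.enc w)
      (Fin.snoc (α := fun _ => Output) y b) i) (Fin.snoc (α := fun _ => Output) y b i)) =
      outLaw α (c.enc w) y * bec α (c.extend.enc w (Fin.last n) y) b := by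
    intro b
    rw [← hinit]
    exact outLaw_snoc α (c.extend.enc w) y b
  simp only [hdec, hlaw]
  split_ifs
  · rw [← Finset.mul_sum, sum_bec, mul_one]
    rfl
  · simp

/-- Strategies as inputs turn a block with feedback into one use of a memoryless channel, to which
`exists_block_code` applies; odd lengths are padded by `FeedbackCode.extend`. -/
theorem mem_feedbackAchievableRates {U : Type} [Fintype U] {α : ℝ} (h0 : 0 ≤ α) (h1 : α ≤ 1)
    {p : U → ℝ} (hp : ∀ u, 0 ≤ p u) (hp1 : ∑ u, p u = 1) {σ : U → Fin 2 × (Output → Fin 2)}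
    (hσ : ∀ u, (σ u).1 = 0 ∨ ∀ b, (σ u).2 b = 0) {s : Output × Output → ℝ}
    (hs : ∀ u v, blockBec α (σ u) v ≠ 0 →
      (∑ u', p u' * blockBec α (σ u') v) * Real.exp (s v) ≤ blockBec α (σ u) v) {R : ℝ}
    (hR0 : 0 ≤ R) (hR : 2 * Real.log 2 * R < ∑ u, ∑ v, p u * blockBec α (σ u) v * s v) :
    R ∈ feedbackAchievableRates α := by
  obtain ⟨γ, hγ1, hγ2⟩ := exists_between hR
  have hW0 : ∀ u v, 0 ≤ blockBec α (σ u) v := fun u v =>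
    mul_nonneg (bec_nonneg h0 h1 _ _) (bec_nonneg h0 h1 _ _)
  have hW1 : ∀ u, ∑ v, blockBec α (σ u) v = 1 := fun u => by
    simp only [blockBec, Fintype.sum_prod_type, ← Finset.mul_sum, sum_bec, mul_one]
  obtain ⟨ρ, hρ0, hρ1, hcode⟩ := exists_block_code hp hp1 hW0 hW1 (s := fun _ v => s v) hs hγ2
  have key : ∀ k M : ℕ, 0 < M → ∃ c : FeedbackCode M (2 * k),
      c.errorProb α ≤ ρ ^ k + M * Real.exp (-(k * γ)) := by
    intro k M hM
    obtain ⟨c, d, hcd⟩ := hcode k M hM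
    refine ⟨blockCode (fun w j => σ (c w j)) (fun w j => hσ _) d, ?_⟩
    rw [blockCode_errorProb]
    have hM' : (0 : ℝ) < M := by exact_mod_cast hM
    rw [one_div, inv_mul_le_iff₀ hM']
    refine (Finset.sum_le_sum fun w _ => hcd w).trans (le_of_eq ?_)
    simp [mul_add]
  have key2 : ∀ n : ℕ, ∃ c : FeedbackCode ⌈(2 : ℝ) ^ ((n : ℝ) * R)⌉₊ n,
      c.errorProb α ≤ ρ ^ (n / 2) +
        ⌈(2 : ℝ) ^ ((n : ℝ) * R)⌉₊ * Real.exp (-((n / 2 : ℕ) * γ)) := by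
    intro n
    generalize hMdef : ⌈(2 : ℝ) ^ ((n : ℝ) * R)⌉₊ = M
    have hM : 0 < M := by
      rw [← hMdef]
      exact Nat.ceil_pos.mpr (by positivity)
    clear hMdef
    obtain ⟨k, rfl | rfl⟩ : ∃ k, n = 2 * k ∨ n = 2 * k + 1 := ⟨n / 2, by omega⟩
    · rw [show 2 * k / 2 = k by omega]
      exact key k M hM
    · rw [show (2 * k + 1) / 2 = k by omega]
      obtain ⟨c, hc⟩ := key k M hM
      exact ⟨c.extend, by rwa [FeedbackCode.extend_errorProb]⟩
  choose c hc using key2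
  refine ⟨hR0, c, ?_⟩
  have hdiv : Tendsto (fun n : ℕ => n / 2) atTop atTop :=
    Nat.tendsto_div_const_atTop (by norm_num)
  -- Compares the `2 ^ (n * R)` messages with `exp (-k * γ)`, where `n ≤ 2 * k + 1`. The odd use
  -- costs a factor `2 ^ R` and the ceiling a factor `2`.
  set θ := Real.exp (2 * Real.log 2 * R - γ) with hθ
  have hθ1 : θ < 1 := Real.exp_lt_one_iff.mpr (by linarith)
  have hlim : Tendsto (fun n : ℕ => ρ ^ (n / 2) + 2 * (2 : ℝ) ^ R * θ ^ (n / 2)) atTop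
      (𝓝 (0 + 2 * (2 : ℝ) ^ R * 0)) :=
    ((tendsto_pow_atTop_nhds_zero_of_lt_one hρ0 hρ1).comp hdiv).add
      (((tendsto_pow_atTop_nhds_zero_of_lt_one (Real.exp_nonneg _) hθ1).comp hdiv).const_mul _)
  rw [mul_zero, add_zero] at hlim
  refine squeeze_zero (fun n => ?_) (fun n => (hc n).trans ?_) hlim
  · refine mul_nonneg (by positivity) (Finset.sum_nonneg fun w _ => Finset.sum_nonneg fun y _ => ?_)
    split_ifs
    · exact outLaw_nonneg h0 h1 _ y
    · exact le_rfl
  · refine add_le_add le_rfl ?_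
    have hn : ((n : ℕ) : ℝ) ≤ 2 * ((n / 2 : ℕ) : ℝ) + 1 := by
      exact_mod_cast (by omega : n ≤ 2 * (n / 2) + 1)
    have hone : (1 : ℝ) ≤ (2 : ℝ) ^ ((n : ℝ) * R) :=
      Real.one_le_rpow (by norm_num) (by positivity)
    have hceil : (⌈(2 : ℝ) ^ ((n : ℝ) * R)⌉₊ : ℝ) ≤ 2 * (2 : ℝ) ^ ((n : ℝ) * R) := by
      have := (Nat.ceil_lt_add_one (by positivity : (0 : ℝ) ≤ (2 : ℝ) ^ ((n : ℝ) * R))).le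
      linarith
    have hpow : (2 : ℝ) ^ ((n : ℝ) * R) ≤
        (2 : ℝ) ^ R * Real.exp ((n / 2 : ℕ) * (2 * Real.log 2 * R)) := by
      rw [Real.rpow_def_of_pos (by norm_num) ((n : ℝ) * R),
        Real.rpow_def_of_pos (by norm_num) R, ← Real.exp_add]
      refine Real.exp_le_exp.mpr ?_
      have := mul_le_mul_of_nonneg_right hn
        (mul_nonneg (Real.log_nonneg (by norm_num : (1 : ℝ) ≤ 2)) hR0)
      linarith
    calc (⌈(2 : ℝ) ^ ((n : ℝ) * R)⌉₊ : ℝ) * Real.exp (-((n / 2 : ℕ) * γ))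
        ≤ (2 * ((2 : ℝ) ^ R * Real.exp ((n / 2 : ℕ) * (2 * Real.log 2 * R)))) *
          Real.exp (-((n / 2 : ℕ) * γ)) :=
          mul_le_mul_of_nonneg_right (by linarith) (Real.exp_nonneg _)
      _ = 2 * (2 : ℝ) ^ R * θ ^ (n / 2) := by
          rw [hθ, ← Real.exp_nat_mul, mul_sub, sub_eq_add_neg, Real.exp_add]
          ring

/-! ### Directed information -/

theorem CausalInput.first_zero (q : CausalInput) : q.first 0 = 1 - q.first 1 := by
  have := q.first_mem.2
  rw [Fin.sum_univ_two] at this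
  linarith

theorem CausalInput.second_zero (q : CausalInput) (x : Fin 2) (y : Output) :
    q.second x y 0 = 1 - q.second x y 1 := by
  have := (q.second_mem x y).2
  rw [Fin.sum_univ_two] at this
  linarith

/-- `P(x₁, x₂, y₁)`. -/
def CausalInput.past (q : CausalInput) (α : ℝ) (a : Fin 2 × Fin 2) (c : Output) : ℝ :=
  q.first a.1 * bec α a.1 c * q.second a.1 c a.2

/-- `P(x₂, y₁)`. -/
def CausalInput.next (q : CausalInput) (α : ℝ) (x : Fin 2) (c : Output) : ℝ :=
  q.past α (0, x) c + q.past α (1, x) c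

theorem CausalInput.past_nonneg (q : CausalInput) {α : ℝ} (h0 : 0 ≤ α) (h1 : α ≤ 1)
    (a : Fin 2 × Fin 2) (c : Output) : 0 ≤ q.past α a c :=
  mul_nonneg (mul_nonneg (q.first_mem.1 _) (bec_nonneg h0 h1 _ _)) ((q.second_mem _ _).1 _)

theorem CausalInput.past_le_next (q : CausalInput) {α : ℝ} (h0 : 0 ≤ α) (h1 : α ≤ 1)
    (a : Fin 2 × Fin 2) (c : Output) : q.past α a c ≤ q.next α a.2 c := by
  obtain ⟨x, y⟩ := a
  have e0 := q.past_nonneg h0 h1 (0, y) c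
  have e1 := q.past_nonneg h0 h1 (1, y) c
  fin_cases x <;> simp [CausalInput.next, e0, e1]

theorem CausalInput.joint_eq (q : CausalInput) (α : ℝ) (ω : Fin 2 × Output × Fin 2 × Output) :
    q.joint α ω = q.past α (ω.1, ω.2.2.1) ω.2.1 * bec α ω.2.2.1 ω.2.2.2 := rfl

section Marginals

variable (q : CausalInput) (α : ℝ)

/-- The four coordinates are only regrouped, so one outcome contributes. The other marginals follow
by summing coordinates out. -/
theorem CausalInput.prob_past_out (a : Fin 2 × Fin 2) (b c : Output) :
    prob (q.joint α) (fun ω => ((ω.1, ω.2.2.1), ω.2.2.2, ω.2.1)) (a, b, c) =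
      q.past α a c * bec α a.2 b := by
  obtain ⟨x, y⟩ := a
  unfold prob
  rw [Finset.sum_eq_single (x, c, y, b)]
  · rw [if_pos rfl, CausalInput.joint_eq]
  · rintro ⟨x', c', y', b'⟩ - hne
    rw [if_neg]
    simp only [ne_eq, Prod.mk.injEq] at hne ⊢
    tauto
  · simp

theorem CausalInput.prob_past (a : Fin 2 × Fin 2) (c : Output) :
    prob (q.joint α) (fun ω => ((ω.1, ω.2.2.1), ω.2.1)) (a, c) = q.past α a c := by
  have : prob (q.joint α) (fun ω => ((ω.1, ω.2.2.1), ω.2.1)) (a, c) =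
      ∑ b, prob (q.joint α) (fun ω => ((ω.1, ω.2.2.1), ω.2.2.2, ω.2.1)) (a, b, c) := by
    unfold prob
    rw [Finset.sum_comm]
    refine Finset.sum_congr rfl fun ω _ => ?_
    simp only [Prod.mk.injEq]
    by_cases h1 : (ω.1, ω.2.2.1) = a <;> by_cases h2 : ω.2.1 = c <;> simp [h1, h2]
  rw [this]
  simp only [CausalInput.prob_past_out, ← Finset.mul_sum, sum_bec, mul_one]

theorem CausalInput.prob_outputs (b c : Output) :
    prob (q.joint α) (fun ω => (ω.2.2.2, ω.2.1)) (b, c) =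
      q.next α 0 c * bec α 0 b + q.next α 1 c * bec α 1 b := by
  have : prob (q.joint α) (fun ω => (ω.2.2.2, ω.2.1)) (b, c) =
      ∑ a, prob (q.joint α) (fun ω => ((ω.1, ω.2.2.1), ω.2.2.2, ω.2.1)) (a, b, c) := by
    unfold prob
    rw [Finset.sum_comm]
    refine Finset.sum_congr rfl fun ω _ => ?_
    simp only [Prod.mk.injEq]
    by_cases h1 : ω.2.2.2 = b <;> by_cases h2 : ω.2.1 = c <;> simp [h1, h2]
  rw [this]
  simp only [CausalInput.prob_past_out, Fintype.sum_prod_type, Fin.sum_univ_two, CausalInput.next]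
  ring

theorem CausalInput.prob_first_output (c : Output) :
    prob (q.joint α) (fun ω => ω.2.1) c = q.next α 0 c + q.next α 1 c := by
  have : prob (q.joint α) (fun ω => ω.2.1) c =
      ∑ a, prob (q.joint α) (fun ω => ((ω.1, ω.2.2.1), ω.2.1)) (a, c) := by
    unfold prob
    rw [Finset.sum_comm]
    refine Finset.sum_congr rfl fun ω _ => ?_
    simp only [Prod.mk.injEq]
    by_cases h2 : ω.2.1 = c <;> simp [h2]
  rw [this]
  simp only [CausalInput.prob_past, Fintype.sum_prod_type, Fin.sum_univ_two, CausalInput.next]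
  ring

theorem CausalInput.prob_first_pair (x : Fin 2) (c : Output) :
    prob (q.joint α) (fun ω => (ω.1, ω.2.1)) (x, c) = q.first x * bec α x c := by
  have : prob (q.joint α) (fun ω => (ω.1, ω.2.1)) (x, c) =
      ∑ y, prob (q.joint α) (fun ω => ((ω.1, ω.2.2.1), ω.2.1)) ((x, y), c) := by
    unfold prob
    rw [Finset.sum_comm]
    refine Finset.sum_congr rfl fun ω _ => ?_
    simp only [Prod.mk.injEq]
    by_cases h1 : ω.1 = x <;> by_cases h2 : ω.2.1 = c <;> simp [h1, h2]
  rw [this]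
  simp only [CausalInput.prob_past, CausalInput.past, ← Finset.mul_sum, (q.second_mem x c).2,
    mul_one]

theorem CausalInput.prob_first (x : Fin 2) :
    prob (q.joint α) (fun ω => ω.1) x = q.first x := by
  have : prob (q.joint α) (fun ω => ω.1) x =
      ∑ c, prob (q.joint α) (fun ω => (ω.1, ω.2.1)) (x, c) := by
    unfold prob
    rw [Finset.sum_comm]
    refine Finset.sum_congr rfl fun ω _ => ?_
    simp only [Prod.mk.injEq]
    by_cases h1 : ω.1 = x <;> simp [h1]
  rw [this]
  simp only [CausalInput.prob_first_pair, ← Finset.mul_sum, sum_bec, mul_one]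

end Marginals

/-- Disposes of the terms with an erased output, which carry no information; `y = 0` is covered by
the conventions for division and logarithm. -/
theorem mul_log_div_self_eq_zero (x y : ℝ) : x * Real.logb 2 (y / y) = 0 := by
  by_cases h : y = 0 <;> simp [h]

theorem logb_two_mul_log (x : ℝ) : Real.logb 2 x * Real.log 2 = Real.log x :=
  div_mul_cancel₀ _ (Real.log_pos (by norm_num)).ne'

theorem negMulLog_add_sub (z a : ℝ) :
    Real.negMulLog (z * a) + Real.negMulLog (z * (1 - a)) - Real.negMulLog z =
      z * Real.binEntropy a := by
  rw [Real.binEntropy_eq_negMulLog_add_negMulLog_one_sub, Real.negMulLog_mul, Real.negMulLog_mul]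
  ring

theorem mutualInfo_mul_log (q : CausalInput) (α : ℝ) :
    mutualInfo (q.joint α) (fun ω => ω.1) (fun ω => ω.2.1) * Real.log 2 =
      (1 - α) * Real.binEntropy (q.first 1) := by
  have hY : ∀ c, prob (q.joint α) (fun ω => ω.2.1) c =
      q.first 0 * bec α 0 c + q.first 1 * bec α 1 c := by
    intro c
    rw [CausalInput.prob_first_output]
    simp only [CausalInput.next, CausalInput.past, CausalInput.second_zero]
    ring
  have hx : ∀ x : Fin 2, (∑ c, q.first x * bec α x c * Real.logb 2 (q.first x * bec α x c /
      (q.first x * (q.first 0 * bec α 0 c + q.first 1 * bec α 1 c)))) * Real.log 2 =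
      (1 - α) * Real.negMulLog (q.first x) := by
    intro x
    have hnone : q.first 0 * α + q.first 1 * α = α := by rw [q.first_zero]; ring
    have hsome : q.first x * (1 - α) * Real.logb 2 (q.first x * (1 - α) /
        (q.first x * (q.first x * (1 - α)))) * Real.log 2 =
        (1 - α) * Real.negMulLog (q.first x) := by
      rw [mul_assoc, logb_two_mul_log]
      by_cases h : q.first x * (1 - α) = 0
      · rw [h, zero_mul]
        rcases mul_eq_zero.mp h with h | h <;> simp [h]
      · rw [mul_comm (q.first x) (q.first x * (1 - α)), ← div_div, div_self h, one_div,
          Real.log_inv, Real.negMulLog]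
        ring
    rw [Fintype.sum_option, Fin.sum_univ_two]
    simp only [bec_none, bec_some, hnone, mul_log_div_self_eq_zero]
    rw [← hsome]
    fin_cases x <;> simp
  unfold mutualInfo
  simp only [CausalInput.prob_first_pair, CausalInput.prob_first, hY]
  rw [Fin.sum_univ_two, add_mul, hx, hx, Real.binEntropy_eq_negMulLog_add_negMulLog_one_sub,
    ← q.first_zero]
  ring

/-- `Y₂` reveals `X₂` with probability `1 - α` and nothing otherwise, so the value is `(1 - α) H(X₂
| Y₁)`, written as `H(X₂, Y₁) - H(Y₁)` term by term in `y₁`. -/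
theorem condMutualInfo_mul_log (q : CausalInput) {α : ℝ} (h0 : 0 ≤ α) (h1 : α ≤ 1) :
    condMutualInfo (q.joint α) (fun ω => (ω.1, ω.2.2.1)) (fun ω => ω.2.2.2) (fun ω => ω.2.1)
      * Real.log 2 =
      (1 - α) * ∑ c, (Real.negMulLog (q.next α 1 c) + Real.negMulLog (q.next α 0 c) -
        Real.negMulLog (q.next α 0 c + q.next α 1 c)) := by
  have ha : ∀ (a : Fin 2 × Fin 2) (c : Output), (∑ b, q.past α a c * bec α a.2 b *
      Real.logb 2 ((q.next α 0 c + q.next α 1 c) * (q.past α a c * bec α a.2 b) /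
        (q.past α a c * (q.next α 0 c * bec α 0 b + q.next α 1 c * bec α 1 b)))) * Real.log 2 =
      (1 - α) * (q.past α a c * (Real.log (q.next α 0 c + q.next α 1 c) -
        Real.log (q.next α a.2 c))) := by
    intro a c
    set Z := q.next α 0 c + q.next α 1 c with hZ
    have hn : ∀ x, 0 ≤ q.next α x c := fun x =>
      add_nonneg (q.past_nonneg h0 h1 _ c) (q.past_nonneg h0 h1 _ c)
    have hnone : Z * (q.past α a c * α) = q.past α a c * (q.next α 0 c * α + q.next α 1 c * α) := by
      rw [hZ]
      ring
    have hsome : q.past α a c * (1 - α) * Real.logb 2 (Z * (q.past α a c * (1 - α)) /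
        (q.past α a c * (q.next α a.2 c * (1 - α)))) * Real.log 2 =
        (1 - α) * (q.past α a c * (Real.log Z - Real.log (q.next α a.2 c))) := by
      rw [mul_assoc, logb_two_mul_log]
      by_cases h : q.past α a c * (1 - α) = 0
      · rw [h, zero_mul]
        rcases mul_eq_zero.mp h with h | h <;> simp [h]
      · have hp : 0 < q.past α a c :=
          lt_of_le_of_ne (q.past_nonneg h0 h1 a c) (Ne.symm (left_ne_zero_of_mul h))
        have hm : 0 < q.next α a.2 c := hp.trans_le (q.past_le_next h0 h1 a c)
        have hZ0 : 0 < Z := by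
          refine hm.trans_le ?_
          obtain ⟨x, y⟩ := a
          have e0 := hn 0
          have e1 := hn 1
          fin_cases y <;> simp [hZ, e0, e1]
        rw [show Z * (q.past α a c * (1 - α)) / (q.past α a c * (q.next α a.2 c * (1 - α))) =
          Z / q.next α a.2 c by
            have := left_ne_zero_of_mul h
            have := right_ne_zero_of_mul h
            field_simp, Real.log_div hZ0.ne' hm.ne']
        ring
    rw [Fintype.sum_option, Fin.sum_univ_two]
    simp only [bec_none, bec_some, hnone, mul_log_div_self_eq_zero]
    rw [← hsome]
    obtain ⟨x, y⟩ := a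
    fin_cases y <;> simp
  unfold condMutualInfo
  simp only [CausalInput.prob_past_out, CausalInput.prob_past, CausalInput.prob_outputs,
    CausalInput.prob_first_output]
  rw [Finset.sum_mul]
  have hswap : ∀ a : Fin 2 × Fin 2, (∑ b, ∑ c, q.past α a c * bec α a.2 b *
      Real.logb 2 ((q.next α 0 c + q.next α 1 c) * (q.past α a c * bec α a.2 b) /
        (q.past α a c * (q.next α 0 c * bec α 0 b + q.next α 1 c * bec α 1 b)))) * Real.log 2 =
      ∑ c, (1 - α) * (q.past α a c * (Real.log (q.next α 0 c + q.next α 1 c) -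
        Real.log (q.next α a.2 c))) := by
    intro a
    rw [Finset.sum_comm, Finset.sum_mul]
    exact Finset.sum_congr rfl fun c _ => ha a c
  rw [Finset.sum_congr rfl fun a _ => hswap a, Finset.sum_comm, Finset.mul_sum]
  refine Finset.sum_congr rfl fun c _ => ?_
  simp only [Fintype.sum_prod_type, Fin.sum_univ_two, Real.negMulLog, CausalInput.next]
  ring

/-- Directed information, in nats, as a combination of binary entropies. -/
theorem directedInfo_mul_log (q : CausalInput) {α : ℝ} (h0 : 0 ≤ α) (h1 : α ≤ 1) :
    directedInfo α q * Real.log 2 = (1 - α) * (Real.binEntropy (q.first 1) +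
      (1 - α) * (1 - q.first 1) * Real.binEntropy (q.second 0 (some 0) 1) +
        α * Real.binEntropy ((1 - q.first 1) * q.second 0 none 1)) := by
  unfold directedInfo
  rw [add_mul, mutualInfo_mul_log, condMutualInfo_mul_log q h0 h1, Fintype.sum_option,
    Fin.sum_univ_two]
  have e1 : ∀ x, q.next α x (some 0) = (1 - α) * (1 - q.first 1) * q.second 0 (some 0) x := by
    intro x
    simp [CausalInput.next, CausalInput.past, q.first_zero]
    left
    ring
  -- After `y₁ = 1` the battery is known to be empty, so no entropy remains. After an erasure the
  -- receiver sees the mixture over `x₁`, hence the product inside the last entropy.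
  have e2 : q.next α 1 (some 1) = 0 := by
    simp [CausalInput.next, CausalInput.past, q.energy]
  have e3 : q.next α 1 none = α * ((1 - q.first 1) * q.second 0 none 1) := by
    simp [CausalInput.next, CausalInput.past, q.energy, q.first_zero]
    ring
  have e4 : q.next α 0 none = α * (1 - (1 - q.first 1) * q.second 0 none 1) := by
    simp [CausalInput.next, CausalInput.past, q.energy, q.first_zero, q.second_zero]
    ring
  have e5 : ∀ z a : ℝ, z * (1 - a) + z * a = z := fun z a => by ring
  rw [e1, e1, e2, e3, e4, q.second_zero, e5, e5, negMulLog_add_sub, negMulLog_add_sub]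
  simp
  ring

/-! ### The optimal block strategy with feedback -/

/-- Probability that a symbol is erased (`none`) or received. -/
def erasureWeight (α : ℝ) (b : Output) : ℝ := if b = none then α else 1 - α

theorem bec_le_erasureWeight {α : ℝ} (h1 : α ≤ 1) (x : Fin 2) (b : Output) :
    bec α x b ≤ erasureWeight α b := by
  unfold bec erasureWeight
  split_ifs <;> linarith

theorem erasureWeight_nonneg {α : ℝ} (h0 : 0 ≤ α) (h1 : α ≤ 1) (b : Output) :
    0 ≤ erasureWeight α b := by
  unfold erasureWeight
  split_ifs <;> linarith

theorem bec_eq_erasureWeight {α : ℝ} {x : Fin 2} {b : Output} (h : bec α x b ≠ 0) :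
    bec α x b = erasureWeight α b := by
  unfold bec erasureWeight at *
  split_ifs at * <;> first | rfl | exact absurd rfl h

/-- Strategies `(x₁, y₁ ↦ x₂)`: send `1` first, or send `0` first and then one of three functions
of the first output. -/
def strategy : Fin 4 → Fin 2 × (Output → Fin 2) :=
  ![(1, fun _ => 0), (0, fun _ => 1), (0, fun b => if b = none then 1 else 0), (0, fun _ => 0)]

/-- Law of the strategy when `x₁ = 1` has probability `p`. -/
def strategyLaw (p : ℝ) : Fin 4 → ℝ := ![p, (1 - p) / 2, p / 2, 1 / 2 - p]

/-- Law of the two outputs of a block. -/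
def feedbackLaw (α p : ℝ) (b c : Output) : ℝ :=
  ∑ u, strategyLaw p u * blockBec α (strategy u) (b, c)

/-- Logarithm of the likelihood ratio to `feedbackLaw`. -/
def feedbackScore (p : ℝ) (b c : Output) : ℝ :=
  (if b = none then 0 else if b = some 0 then -Real.log (1 - p) else -Real.log p) +
    if c = none ∨ b = some 1 then 0 else Real.log 2

theorem strategy_feasible (u : Fin 4) : (strategy u).1 = 0 ∨ ∀ b, (strategy u).2 b = 0 := by
  fin_cases u <;> simp [strategy]

theorem strategyLaw_nonneg {p : ℝ} (hp0 : 0 < p) (hp : p ≤ 1 / 2) (u : Fin 4) :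
    0 ≤ strategyLaw p u := by
  fin_cases u <;> simp [strategyLaw] <;> linarith

theorem sum_strategyLaw (p : ℝ) : ∑ u, strategyLaw p u = 1 := by
  simp [strategyLaw, Fin.sum_univ_four]
  ring

/-- The weights in `strategyLaw` make `x₂` uniform both after `y₁ = 0`, as `(1 - p) / 2` out of `1 -
p`, and after an erasure, as `(1 - p) / 2 + p / 2`. So each received symbol contributes the inverse
of its conditional probability, and only the erasure weights survive. -/
theorem feedbackLaw_mul_exp {α p : ℝ} (hp0 : 0 < p) (hp1 : p < 1) (b c : Output) :
    feedbackLaw α p b c * Real.exp (feedbackScore p b c) =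
      if b = some 1 ∧ c = some 1 then 0 else erasureWeight α b * erasureWeight α c := by
  have hq : 0 < 1 - p := by linarith
  have e1 : Real.exp (-Real.log p) = p⁻¹ := by rw [Real.exp_neg, Real.exp_log hp0]
  have e0 : Real.exp (-Real.log (1 - p)) = (1 - p)⁻¹ := by rw [Real.exp_neg, Real.exp_log hq]
  have e2 : Real.exp (Real.log 2) = 2 := Real.exp_log (by norm_num)
  have hp' := hp0.ne'
  have hq' := hq.ne'
  unfold feedbackScore feedbackLaw erasureWeight
  rw [Real.exp_add]
  rcases b with _ | b <;> rcases c with _ | c <;> (try fin_cases b) <;> (try fin_cases c) <;>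
    simp [Fin.sum_univ_four, strategyLaw, strategy, blockBec, e0, e1, e2] <;>
    field_simp <;> ring

theorem sum_feedbackLaw (α p : ℝ) : ∑ b, ∑ c, feedbackLaw α p b c = 1 := by
  have h : ∀ u, ∑ b, ∑ c, blockBec α (strategy u) (b, c) = 1 := fun u => by
    simp only [blockBec, ← Finset.mul_sum, sum_bec, mul_one]
  unfold feedbackLaw
  rw [Finset.sum_congr rfl fun b _ => Finset.sum_comm, Finset.sum_comm]
  simp only [← Finset.mul_sum, h, mul_one, sum_strategyLaw]

theorem feedbackLaw_nonneg {α p : ℝ} (h0 : 0 ≤ α) (h1 : α ≤ 1) (hp0 : 0 < p) (hp : p ≤ 1 / 2)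
    (b c : Output) : 0 ≤ feedbackLaw α p b c :=
  Finset.sum_nonneg fun u _ => mul_nonneg (strategyLaw_nonneg hp0 hp u)
    (mul_nonneg (bec_nonneg h0 h1 _ _) (bec_nonneg h0 h1 _ _))

/-- The choice of `p` equalizes the strategies: the surplus `-log p + log (1 - p)` for `x = 1`
matches the lost second score `(1 - α) log 2`. Equality is what lets the same score serve the
converse and the code construction. -/
theorem sum_bec_mul_feedbackScore {α p : ℝ} {x : Fin 2} {g : Output → Fin 2}
    (hp : -Real.log p = -Real.log (1 - p) + (1 - α) * Real.log 2)
    (hg : x = 0 ∨ ∀ b, g b = 0) :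
    ∑ b, ∑ c, bec α x b * bec α (g b) c * feedbackScore p b c =
      (1 - α) * (-Real.log (1 - p) + Real.log 2) := by
  have hs : ∀ b, ∑ c, bec α x b * bec α (g b) c * feedbackScore p b c = bec α x b *
      ((if b = none then 0 else if b = some 0 then -Real.log (1 - p) else -Real.log p) +
        (1 - α) * if b = some 1 then 0 else Real.log 2) := by
    intro b
    have hg2 : g b = 0 ∨ g b = 1 := by omega
    rcases hg2 with h | h <;> rw [h] <;>
      simp [Fintype.sum_option, feedbackScore] <;> split_ifs <;> ring
  simp only [hs, Fintype.sum_option, Fin.sum_univ_two]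
  rw [hp]
  have hx : x = 0 ∨ x = 1 := by omega
  rcases hx with rfl | rfl <;> simp <;> ring

theorem blockBound_feedback {α p : ℝ} (h0 : 0 ≤ α) (h1 : α ≤ 1) (hp0 : 0 < p) (hp1 : p < 1)
    (hp : -Real.log p = -Real.log (1 - p) + (1 - α) * Real.log 2)
    {x : Fin 2} {g : Output → Fin 2} (hg : x = 0 ∨ ∀ b, g b = 0) :
    BlockBound α ((1 - α) * (-Real.log (1 - p) + Real.log 2)) (feedbackScore p)
      (feedbackLaw α p) x g := by
  refine ⟨(sum_bec_mul_feedbackScore hp hg).le, fun b c => ?_⟩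
  rw [feedbackLaw_mul_exp hp0 hp1]
  split_ifs with h
  -- The outputs `(1, 1)`, where `Q` vanishes, are unreachable by the energy constraint.
  · obtain ⟨rfl, rfl⟩ := h
    rcases hg with rfl | hg
    · simp
    · simp [hg]
  · exact mul_le_mul (bec_le_erasureWeight h1 _ _) (bec_le_erasureWeight h1 _ _)
      (bec_nonneg h0 h1 _ _) (erasureWeight_nonneg h0 h1 _)

/-! ### Feedback capacity -/

/-- The optimal probability of `x₁ = 1`. -/
def firstOne (α : ℝ) : ℝ := 1 / (1 + (2 : ℝ) ^ (1 - α))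

theorem firstOne_pos (α : ℝ) : 0 < firstOne α := by
  unfold firstOne
  positivity

theorem firstOne_le_half {α : ℝ} (h1 : α ≤ 1) : firstOne α ≤ 1 / 2 := by
  have : (1 : ℝ) ≤ (2 : ℝ) ^ (1 - α) := Real.one_le_rpow (by norm_num) (by linarith)
  unfold firstOne
  exact one_div_le_one_div_of_le (by norm_num) (by linarith)

theorem neg_log_firstOne (α : ℝ) :
    -Real.log (firstOne α) = Real.log (1 + (2 : ℝ) ^ (1 - α)) := by
  rw [firstOne, one_div, Real.log_inv, neg_neg]

theorem neg_log_one_sub_firstOne (α : ℝ) :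
    -Real.log (1 - firstOne α) =
      Real.log (1 + (2 : ℝ) ^ (1 - α)) - (1 - α) * Real.log 2 := by
  have h : (0 : ℝ) < (2 : ℝ) ^ (1 - α) := by positivity
  have : 1 - firstOne α = (2 : ℝ) ^ (1 - α) / (1 + (2 : ℝ) ^ (1 - α)) := by
    unfold firstOne
    field_simp
    ring
  rw [this, Real.log_div h.ne' (by positivity), Real.log_rpow (by norm_num)]
  ring

/-- The closed form of the feedback capacity. -/
def capacityValue (α : ℝ) : ℝ := (1 - α) / 2 * (Real.logb 2 (1 + (2 : ℝ) ^ (1 - α)) + α)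

theorem two_log_mul_capacityValue (α : ℝ) :
    2 * Real.log 2 * capacityValue α =
      (1 - α) * (Real.log (1 + (2 : ℝ) ^ (1 - α)) + α * Real.log 2) := by
  rw [capacityValue, ← logb_two_mul_log (1 + (2 : ℝ) ^ (1 - α))]
  ring

theorem zero_mem_achievableRates (α : ℝ) : 0 ∈ achievableRates α := by
  have hM : ∀ n : ℕ, ⌈(2 : ℝ) ^ ((n : ℝ) * 0)⌉₊ = 1 := fun n => by simp
  refine ⟨le_rfl, fun n => ⟨fun _ _ => 0, fun _ => ⟨0, by rw [hM]; exact one_pos⟩, fun w => ?_⟩, ?_⟩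
  · rw [energyFeasible_iff]
    exact fun _ _ => Or.inl rfl
  · refine tendsto_const_nhds.congr fun n => ?_
    symm
    have hsub : Subsingleton (Fin ⌈(2 : ℝ) ^ ((n : ℝ) * 0)⌉₊) := by
      rw [hM]
      infer_instance
    unfold Code.errorProb
    refine mul_eq_zero_of_right _ (Finset.sum_eq_zero fun w _ => Finset.sum_eq_zero fun y _ => ?_)
    rw [if_neg]
    exact not_not.mpr (Subsingleton.elim _ _)

theorem achievableRates_subset (α : ℝ) : achievableRates α ⊆ feedbackAchievableRates α :=
  fun _ ⟨h0, c, hc⟩ => ⟨h0, fun n => (c n).toFeedback, hc⟩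

theorem isLUB_feedbackAchievableRates {α : ℝ} (h0 : 0 ≤ α) (h1 : α ≤ 1) :
    IsLUB (feedbackAchievableRates α) (capacityValue α) := by
  have hlog2 : 0 < Real.log 2 := Real.log_pos (by norm_num)
  have hp0 := firstOne_pos α
  have hp := firstOne_le_half h1
  have hp1 : firstOne α < 1 := by linarith
  have hbal : -Real.log (firstOne α) =
      -Real.log (1 - firstOne α) + (1 - α) * Real.log 2 := by
    rw [neg_log_firstOne, neg_log_one_sub_firstOne]
    ring
  have hK : (1 - α) * (-Real.log (1 - firstOne α) + Real.log 2) =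
      2 * Real.log 2 * capacityValue α := by
    rw [two_log_mul_capacityValue, neg_log_one_sub_firstOne]
    ring
  constructor
  · rintro R ⟨-, c, hc⟩
    have := rate_le_of_blockBound h0 h1 (feedbackLaw_nonneg h0 h1 hp0 hp) (sum_feedbackLaw _ _) c
      (fun n w j h y => blockBound_feedback h0 h1 hp0 hp1 hbal ((c n).block_feasible w j h y)) hc
    rwa [hK, mul_div_cancel_left₀ _ (by positivity)] at this
  · intro b hb
    have hb0 : 0 ≤ b := hb (achievableRates_subset α (zero_mem_achievableRates α))
    by_contra hcon
    rw [not_le] at hcon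
    have hmem : (b + capacityValue α) / 2 ∈ feedbackAchievableRates α := by
      refine mem_feedbackAchievableRates h0 h1 (strategyLaw_nonneg hp0 hp) (sum_strategyLaw _)
        strategy_feasible (s := fun v => feedbackScore (firstOne α) v.1 v.2) ?_ (by linarith) ?_
      · rintro u ⟨b, c⟩ hne
        have e : (∑ u', strategyLaw (firstOne α) u' * blockBec α (strategy u') (b, c)) *
            Real.exp (feedbackScore (firstOne α) b c) = _ := feedbackLaw_mul_exp hp0 hp1 b c
        refine e.le.trans ?_
        unfold blockBec at hne ⊢
        rw [bec_eq_erasureWeight (left_ne_zero_of_mul hne),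
          bec_eq_erasureWeight (right_ne_zero_of_mul hne)]
        split_ifs
        · exact mul_nonneg (erasureWeight_nonneg h0 h1 _) (erasureWeight_nonneg h0 h1 _)
        · exact le_rfl
      · have hmean : ∀ u, ∑ v, strategyLaw (firstOne α) u * blockBec α (strategy u) v *
            feedbackScore (firstOne α) v.1 v.2 =
            strategyLaw (firstOne α) u * (2 * Real.log 2 * capacityValue α) := by
          intro u
          rw [← hK, ← sum_bec_mul_feedbackScore hbal (strategy_feasible u)]
          simp only [Fintype.sum_prod_type, Finset.mul_sum, blockBec, mul_assoc]
        simp only [hmean, ← Finset.sum_mul, sum_strategyLaw, one_mul]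
        exact mul_lt_mul_of_pos_left (by linarith) (by positivity)
    have := hb hmem
    linarith

theorem feedbackCapacity_eq {α : ℝ} (h0 : 0 ≤ α) (h1 : α ≤ 1) :
    feedbackCapacity α = capacityValue α :=
  (isLUB_feedbackAchievableRates h0 h1).csSup_eq
    ⟨0, achievableRates_subset α (zero_mem_achievableRates α)⟩

/-! ### Maximal directed information -/

theorem negMulLog_le_cross {x r : ℝ} (hx : 0 ≤ x) (hr : 0 < r) :
    Real.negMulLog x ≤ x * -Real.log r + (r - x) := by
  rcases hx.eq_or_lt with rfl | hx
  · simp [hr.le]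
  · have h := mul_le_mul_of_nonneg_left (Real.log_le_sub_one_of_pos (div_pos hr hx)) hx.le
    rw [Real.log_div hr.ne' hx.ne', mul_sub, mul_sub, mul_div_cancel₀ _ hx.ne'] at h
    rw [Real.negMulLog]
    linarith

/-- Gibbs' inequality; the linear corrections of the two terms cancel. -/
theorem binEntropy_le_cross {x r : ℝ} (hx0 : 0 ≤ x) (hx1 : x ≤ 1) (hr0 : 0 < r) (hr1 : r < 1) :
    Real.binEntropy x ≤ x * -Real.log r + (1 - x) * -Real.log (1 - r) := by
  rw [Real.binEntropy_eq_negMulLog_add_negMulLog_one_sub]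
  have h1 := negMulLog_le_cross hx0 hr0
  have h2 := negMulLog_le_cross (sub_nonneg.mpr hx1) (sub_pos.mpr hr1)
  linarith

/-- Comparing the first entropy with `firstOne α` gives a bound affine in `q.first 1`, whose slope
cancels that of `(1 - α) * (1 - q.first 1) * log 2`. -/
theorem directedInfo_le {α : ℝ} (h0 : 0 ≤ α) (h1 : α ≤ 1) (q : CausalInput) :
    directedInfo α q ≤ 2 * capacityValue α := by
  have hlog2 : 0 < Real.log 2 := Real.log_pos (by norm_num)
  refine le_of_mul_le_mul_right ?_ hlog2
  rw [directedInfo_mul_log q h0 h1, mul_right_comm 2, two_log_mul_capacityValue]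
  refine mul_le_mul_of_nonneg_left ?_ (by linarith)
  have hx0 : 0 ≤ q.first 1 := q.first_mem.1 1
  have hx1 : q.first 1 ≤ 1 := by
    have := q.first_mem.1 0
    rw [q.first_zero] at this
    linarith
  have hH := binEntropy_le_cross hx0 hx1 (firstOne_pos α)
    ((firstOne_le_half h1).trans_lt (by norm_num))
  rw [neg_log_firstOne, neg_log_one_sub_firstOne] at hH
  have hA : (1 - α) * (1 - q.first 1) * Real.binEntropy (q.second 0 (some 0) 1) ≤
      (1 - α) * (1 - q.first 1) * Real.log 2 :=
    mul_le_mul_of_nonneg_left Real.binEntropy_le_log_two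
      (mul_nonneg (by linarith) (by linarith))
  have hB : α * Real.binEntropy ((1 - q.first 1) * q.second 0 none 1) ≤ α * Real.log 2 :=
    mul_le_mul_of_nonneg_left Real.binEntropy_le_log_two h0
  linarith

theorem pair_mem_stdSimplex {r : ℝ} (h0 : 0 ≤ r) (h1 : r ≤ 1) :
    ![1 - r, r] ∈ stdSimplex ℝ (Fin 2) := by
  refine ⟨fun i => ?_, by simp⟩
  fin_cases i <;> simp [h0, h1]

/-- The probability of `x₂ = 1` given `x₁ = 0` in the optimal input distribution. -/
def secondOne (p : ℝ) (y : Output) : ℝ :=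
  if y = none then min (1 / (2 * (1 - p))) 1 else 1 / 2

theorem secondOne_mem {p : ℝ} (hp : p ≤ 1 / 2) (y : Output) :
    0 ≤ secondOne p y ∧ secondOne p y ≤ 1 := by
  have : 0 < 1 - p := by linarith
  unfold secondOne
  split_ifs
  · exact ⟨le_min (by positivity) zero_le_one, min_le_right _ _⟩
  · norm_num

/-- An input distribution that maximizes the directed information. -/
def optimalInput {α : ℝ} (h1 : α ≤ 1) : CausalInput where
  first := ![1 - firstOne α, firstOne α]
  second x y := if x = 0 then ![1 - secondOne (firstOne α) y, secondOne (firstOne α) y]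
    else ![1 - 0, 0]
  first_mem := pair_mem_stdSimplex (firstOne_pos α).le
    ((firstOne_le_half h1).trans (by norm_num))
  second_mem x y := by
    split_ifs
    · exact pair_mem_stdSimplex (secondOne_mem (firstOne_le_half h1) y).1
        (secondOne_mem (firstOne_le_half h1) y).2
    · exact pair_mem_stdSimplex le_rfl zero_le_one
  energy y := by simp

theorem directedInfo_optimalInput {α : ℝ} (h0 : 0 ≤ α) (h1 : α ≤ 1) :
    directedInfo α (optimalInput h1) = 2 * capacityValue α := by
  have hlog2 : 0 < Real.log 2 := Real.log_pos (by norm_num)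
  have hp := firstOne_le_half h1
  have hq : 0 < 1 - firstOne α := by linarith
  refine mul_right_cancel₀ hlog2.ne' ?_
  rw [directedInfo_mul_log _ h0 h1, mul_right_comm 2, two_log_mul_capacityValue]
  have e1 : (optimalInput h1).first 1 = firstOne α := rfl
  have e2 : (optimalInput h1).second 0 (some 0) 1 = 2⁻¹ := by
    simp [optimalInput, secondOne]
  -- Since `firstOne α ≤ 1 / 2`, the minimum is its first argument, which makes `x₂` uniform after
  -- an erasure.
  have e3 : (1 - firstOne α) * (optimalInput h1).second 0 none 1 = 2⁻¹ := by
    have : 1 / (2 * (1 - firstOne α)) ≤ 1 := by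
      rw [div_le_one (by positivity)]
      linarith
    have e : (optimalInput h1).second 0 none 1 = 1 / (2 * (1 - firstOne α)) := by
      simp only [optimalInput, secondOne, if_true, min_eq_left this]
      rfl
    rw [e]
    field_simp
  have e4 : Real.binEntropy (firstOne α) = firstOne α * -Real.log (firstOne α) +
      (1 - firstOne α) * -Real.log (1 - firstOne α) := by
    rw [Real.binEntropy_eq_negMulLog_add_negMulLog_one_sub, Real.negMulLog, Real.negMulLog]
    ring
  rw [e1, e2, e3, Real.binEntropy_two_inv, e4, neg_log_firstOne, neg_log_one_sub_firstOne]
  ring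

/-! ### Comparison with the capacity without feedback -/

/-- Reference law of the outputs of a block, for erasure probability `1/2`. -/
def plainLaw (b c : Output) : ℝ :=
  match b, c with
  | none, none => 1 / 4
  | none, some x => if x = 0 then 5 / 32 else 3 / 32
  | some x, none => if x = 0 then 5 / 32 else 3 / 32
  | some x, some x' => if x = 0 then (if x' = 0 then 1 / 16 else 3 / 32)
      else (if x' = 0 then 3 / 32 else 0)

/-- Logarithm of the likelihood ratio to `plainLaw`. -/
def plainScore (b c : Output) : ℝ :=
  match b, c with
  | none, none => 0
  | none, some x => if x = 0 then Real.log (8 / 5) else Real.log (8 / 3)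
  | some x, none => if x = 0 then Real.log (8 / 5) else Real.log (8 / 3)
  | some x, some x' => if x = 0 ∧ x' = 0 then Real.log 4 else Real.log (8 / 3)

theorem plainLaw_nonneg (b c : Output) : 0 ≤ plainLaw b c := by
  unfold plainLaw
  rcases b with _ | b <;> rcases c with _ | c <;> dsimp only <;> (try split_ifs) <;> norm_num

theorem sum_plainLaw : ∑ b, ∑ c, plainLaw b c = 1 := by
  simp [Fintype.sum_option, Fin.sum_univ_two, plainLaw]
  norm_num

/-- `plainLaw` is the output law of the input pairs `10`, `01`, `00` with weights `3/8`, `3/8`,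
`1/4`. The first two have mean score exactly the stated bound, the third less; only an upper bound
is needed. -/
theorem blockBound_plain {x x' : Fin 2} (h : x = 0 ∨ x' = 0) :
    BlockBound (1 / 2) (1 / 4 * Real.log (512 / 45)) plainScore plainLaw x (fun _ => x') := by
  have e : Real.log (512 / 45) = Real.log (8 / 5) + 2 * Real.log (8 / 3) := by
    rw [← Real.log_rpow (by norm_num), ← Real.log_mul (by norm_num) (by positivity)]
    norm_num
  have e' : Real.log 4 + 2 * Real.log (8 / 5) ≤ Real.log (512 / 45) := by
    rw [← Real.log_rpow (by norm_num), ← Real.log_mul (by norm_num) (by positivity)]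
    refine Real.log_le_log (by positivity) ?_
    norm_num
  have e3 : Real.exp (Real.log (8 / 3)) = 8 / 3 := Real.exp_log (by norm_num)
  have e5 : Real.exp (Real.log (8 / 5)) = 8 / 5 := Real.exp_log (by norm_num)
  have e4 : Real.exp (Real.log 4) = 4 := Real.exp_log (by norm_num)
  have hx : (x = 0 ∧ x' = 0) ∨ (x = 0 ∧ x' = 1) ∨ (x = 1 ∧ x' = 0) := by omega
  constructor
  · rcases hx with ⟨rfl, rfl⟩ | ⟨rfl, rfl⟩ | ⟨rfl, rfl⟩ <;>
      simp only [Fintype.sum_option, Fin.sum_univ_two, plainScore, bec_none, bec_some] <;>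
      norm_num <;> linarith
  · intro b c
    rcases hx with ⟨rfl, rfl⟩ | ⟨rfl, rfl⟩ | ⟨rfl, rfl⟩ <;>
      rcases b with _ | b <;> rcases c with _ | c <;> (try fin_cases b) <;> (try fin_cases c) <;>
      simp [plainScore, plainLaw, e3, e4, e5] <;> norm_num

/-- Ignoring feedback makes the second input of each block constant in `y₁`, so the block bound is
required only for constant `g`. -/
theorem achievableRates_half_le {R : ℝ} (hR : R ∈ achievableRates (1 / 2)) :
    R ≤ 1 / 4 * Real.log (512 / 45) / (2 * Real.log 2) := by
  obtain ⟨-, c, hc⟩ := hR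
  refine rate_le_of_blockBound (s := plainScore) (by norm_num) (by norm_num) plainLaw_nonneg sum_plainLaw
    (fun n => (c n).toFeedback) (fun n w j h y => ?_) hc
  exact blockBound_plain ((energyFeasible_iff _).mp ((c n).feasible w) j h)

theorem capacityValue_half :
    capacityValue (1 / 2) = 1 / 4 * (Real.logb 2 (1 + √2) + 1 / 2) := by
  rw [capacityValue, Real.sqrt_eq_rpow]
  norm_num

theorem plain_bound_lt_capacityValue :
    1 / 4 * Real.log (512 / 45) / (2 * Real.log 2) < capacityValue (1 / 2) := by
  have hlog2 : 0 < Real.log 2 := Real.log_pos (by norm_num)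
  have hs : (1.4 : ℝ) < √2 := Real.lt_sqrt_of_sq_lt (by norm_num)
  -- Amounts to `512 / 45 < 2 * (1 + √2) ^ 2`, for which `√2 > 1.4` suffices.
  have h1 : Real.log (512 / 45) < 2 * Real.log (1 + √2) + Real.log 2 := by
    rw [← Real.log_rpow (by positivity), ← Real.log_mul (by positivity) (by norm_num)]
    refine Real.log_lt_log (by norm_num) ?_
    rw [Real.rpow_two]
    nlinarith
  rw [div_lt_iff₀ (by positivity), capacityValue_half]
  have := logb_two_mul_log (1 + √2)
  linarith

/-- The numerical claim needs the logarithm between `1.2714` and `1.2718`. These fractions lie in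
that window, and their small denominators reduce the bounds to comparing integer powers. -/
theorem logb_one_add_sqrt_two_mem :
    89 / 70 < Real.logb 2 (1 + √2) ∧ Real.logb 2 (1 + √2) < 103 / 81 := by
  have hl : (1.414213 : ℝ) < √2 := Real.lt_sqrt_of_sq_lt (by norm_num)
  have hu : √2 < (1.414214 : ℝ) := (Real.sqrt_lt' (by norm_num)).mpr (by norm_num)
  constructor
  · rw [div_lt_iff₀ (by norm_num), mul_comm]
    have h : Real.logb 2 ((2 : ℝ) ^ 89) < Real.logb 2 ((1 + √2) ^ 70) := by
      refine Real.logb_lt_logb (by norm_num) (by norm_num) ?_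
      calc (2 : ℝ) ^ 89 < (1 + 1.414213) ^ 70 := by norm_num
        _ ≤ (1 + √2) ^ 70 := by gcongr
    rw [Real.logb_pow, Real.logb_pow, Real.logb_self_eq_one (by norm_num)] at h
    norm_num at h
    exact h
  · rw [lt_div_iff₀ (by norm_num), mul_comm]
    have h : Real.logb 2 ((1 + √2) ^ 81) < Real.logb 2 ((2 : ℝ) ^ 103) := by
      refine Real.logb_lt_logb (by norm_num) (by positivity) ?_
      calc (1 + √2) ^ 81 ≤ ((1 : ℝ) + 1.414214) ^ 81 := by gcongr
        _ < 2 ^ 103 := by norm_num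
    rw [Real.logb_pow, Real.logb_pow, Real.logb_self_eq_one (by norm_num)] at h
    norm_num at h
    exact h

theorem isLUB_capacity_half : IsLUB (achievableRates (1 / 2)) (capacity (1 / 2)) :=
  isLUB_csSup ⟨0, zero_mem_achievableRates _⟩ ⟨_, fun _ hR => achievableRates_half_le hR⟩

end EHBEC

end

theorem mainTheorem2 :
    (∀ α : ℝ, 0 ≤ α → α ≤ 1 →
      IsLUB (EHBEC.feedbackAchievableRates α) (EHBEC.feedbackCapacity α) ∧
      (∃ q : EHBEC.CausalInput,
        q.first 1 = 1 / (1 + (2 : ℝ) ^ (1 - α)) ∧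
        q.second 0 (some 0) 1 = 1 / 2 ∧
        q.second 0 none 1 = min (1 / (2 * (1 - q.first 1))) 1 ∧
        IsGreatest (Set.range (EHBEC.directedInfo α)) (EHBEC.directedInfo α q) ∧
        EHBEC.feedbackCapacity α = 1 / 2 * EHBEC.directedInfo α q) ∧
      EHBEC.feedbackCapacity α =
        (1 - α) / 2 * (Real.logb 2 (1 + (2 : ℝ) ^ (1 - α)) + α)) ∧
    |EHBEC.feedbackCapacity (1 / 2) - 0.4429| < 0.00005 ∧
    IsLUB (EHBEC.achievableRates (1 / 2)) (EHBEC.capacity (1 / 2)) ∧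
    EHBEC.capacity (1 / 2) < EHBEC.feedbackCapacity (1 / 2) := by
  have hhalf : EHBEC.feedbackCapacity (1 / 2) = EHBEC.capacityValue (1 / 2) :=
    EHBEC.feedbackCapacity_eq (by norm_num) (by norm_num)
  refine ⟨fun α h0 h1 => ⟨?_, ⟨EHBEC.optimalInput h1, rfl, ?_, ?_, ?_, ?_⟩, ?_⟩, ?_,
    EHBEC.isLUB_capacity_half, ?_⟩
  · rw [EHBEC.feedbackCapacity_eq h0 h1]
    exact EHBEC.isLUB_feedbackAchievableRates h0 h1
  · simp [EHBEC.optimalInput, EHBEC.secondOne]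
  · rfl
  · refine ⟨Set.mem_range_self _, ?_⟩
    rintro _ ⟨q, rfl⟩
    rw [EHBEC.directedInfo_optimalInput h0 h1]
    exact EHBEC.directedInfo_le h0 h1 q
  · rw [EHBEC.feedbackCapacity_eq h0 h1, EHBEC.directedInfo_optimalInput h0 h1]
    ring
  · exact EHBEC.feedbackCapacity_eq h0 h1
  · obtain ⟨hl, hu⟩ := EHBEC.logb_one_add_sqrt_two_mem
    rw [hhalf, EHBEC.capacityValue_half, abs_lt]
    constructor <;> linarith
  · rw [hhalf]
    -- The uniform bound passes to the supremum, so strictness survives.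
    exact (EHBEC.isLUB_capacity_half.2 fun _ hR => EHBEC.achievableRates_half_le hR).trans_lt
      EHBEC.plain_bound_lt_capacityValue
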